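/- **Theorem (Logarithmic regret of random allocation).** *Model.* Let $1\le U\le C$ be the numbers of users and of channels, and let $\mu=(\mu_1,\dots,\mu_C)\in(0,1)^C$ have distinct entries, $\mu(1^*)>\dots>\mu(C^*)$ in decreasing order. In slot $k=1,2,\dots$ channel $i$ is free iff $W_i(k)=1$, where the $W_i(k)\sim\mathrm{Bernoulli}(\mu_i)$ are independent over $i$ and $k$. In each slot $k$ every user $j$ senses exactly one channel $i$, observes $W_i(k)$, and transmits on $i$ iff $W_i(k)=1$. If two or more users transmit on the same channel in a slot, they collide and none of these transmissions succeeds; a transmission without collision succeeds. Users learn whether their own transmission collided and exchange no information. *Policy $\rho^{\mathrm{RAND}}(U,C,g^{\mathrm{MEAN}})$, run by every user.* In the first $C$ slots user $j$ senses every channel once, in an arbitrary fixed order; its rank is $1$ and collisions in these slots are ignored. Let $T_{i,j}(n)$ be the number of slots among the first $n$ in which user $j$ sensed channel $i$, let $\bar X_{i,j}(n)$ be the fraction of these slots in which it found channel $i$ free, and let $$g_j(i;n)=\bar X_{i,j}(n)+\sqrt{\frac{2\log n}{T_{i,j}(n)}} .$$ In slot $n+1$, $n\ge C$: if the transmission of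 user $j$ in slot $n$ collided (and $n>C$), user $j$ draws a new rank uniformly from $\{1,\dots,U\}$, and otherwise it keeps its rank; then, if its rank is $r$, it senses the channel with the $r$-th highest value among $g_j(1;n),\dots,g_j(C;n)$, where ties are broken by an arbitrary fixed rule that depends only on the vector of these values and may differ between users. All rank draws are independent of each other and of the $W_i(k)$. *Regret.* Let $S(n)$ be the expected total number of successful transmissions of all users in the first $n$ slots, and $R(n)=n\sum_{j=1}^U\mu(j^*)-S(n)$. *Claim.* For all fixed $U$, $C$, $\mu$, sensing orders in the first $C$ slots and tie-breaking rules as above, $R(n)=O(\log n)$; and if $U<C$, then also $R(n)=\Omega(\log n)$, so that $R(n)=\Theta(\log n)$. Here $R(n)=O(\log n)$ means that there are $c>0$ and $n_0$ with $R(n)\le c\log n$ for all $n\ge n_0$, and $R(n)=\Omega(\log n)$ that there are $c'>0$ and $n_0$ with $R(n)\ge c'\log n$ for all $n\ge n_0$. -/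

import Mathlib

open MeasureTheory ProbabilityTheory

noncomputable section

namespace RandAlloc

/-- A ranking rule: `σ v T` is the index of the `T`-th highest entry of the vector `v`
(`T` is counted from `0`). Rules differ only in how they order tied entries. -/
def IsRankingRule {C : ℕ} (σ : (Fin C → ℝ) → Equiv.Perm (Fin C)) : Prop :=
  ∀ v : Fin C → ℝ, Antitone (v ∘ σ v)

/-- The channel with the `T`-th highest mean availability (`T` is counted from `0`). -/
def bestChannel {C : ℕ} (μ : Fin C → unitInterval) : Equiv.Perm (Fin C) :=
  Tuple.sort fun i => -(μ i : ℝ)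

/-- The randomness of one slot: which channels are free of primary transmissions (`true` = free),
and for every user a fresh rank, which that user reads only if it has to draw a new rank. -/
abbrev SlotInput (U C : ℕ) : Type := (Fin C → Bool) × (Fin U → Fin U)

/-- Outcomes: the randomness of all slots. Slot number `k + 1` has index `k`. -/
abbrev Outcome (U C : ℕ) : Type := ℕ → SlotInput U C

/-- Law of one slot: channel `i` is free with probability `μ i`, each fresh rank is uniform on the
`U` ranks, and all these variables are independent. -/
def slotLaw (U : ℕ) {C : ℕ} [NeZero U] (μ : Fin C → unitInterval) : Measure (SlotInput U C) :=
  (Measure.pi fun i : Fin C => bernoulliMeasure true false (μ i)).prod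
    (Measure.pi fun _ : Fin U => uniformOn (Set.univ : Set (Fin U)))

instance {U C : ℕ} [NeZero U] (μ : Fin C → unitInterval) : IsProbabilityMeasure (slotLaw U μ) := by
  unfold slotLaw; infer_instance

/-- The slots are independent and identically distributed. -/
def law (U : ℕ) {C : ℕ} [NeZero U] (μ : Fin C → unitInterval) : Measure (Outcome U C) :=
  Measure.infinitePi fun _ : ℕ => slotLaw U μ

/-- What a user remembers at the end of a slot. -/
structure UserState (U C : ℕ) where
  /-- the current rank, counted from `0` -/
  rank : Fin U
  /-- `sensed i` is the number of slots so far in which the user sensed channel `i` -/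
  sensed : Fin C → ℕ
  /-- `free i` is the number of those slots in which channel `i` was found to be free -/
  free : Fin C → ℕ
  /-- whether the transmission of the user in the last slot collided -/
  collided : Bool

/-- The `g^MEAN` statistic of channel `i` after `n` slots: the sample mean of the sensing results
plus `√(2 log n / T)`, where `T` is the number of slots in which the user sensed channel `i`. -/
def gMean {U C : ℕ} (s : UserState U C) (n : ℕ) (i : Fin C) : ℝ :=
  (s.free i : ℝ) / (s.sensed i : ℝ) + Real.sqrt (2 * Real.log n / (s.sensed i : ℝ))

/-- User `j` is the only user on its channel, if `a` lists the channels that the users sense. -/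
def Alone {U C : ℕ} (a : Fin U → Fin C) (j : Fin U) : Prop :=
  ∀ j' : Fin U, a j' = a j → j' = j

section Policy

variable {U C : ℕ} [NeZero U]

/-- The rank that a user with state `s` employs in the next slot: the fresh rank `d` if its
transmission in the last slot collided, and its current rank otherwise. -/
def nextRank (s : UserState U C) (d : Fin U) : Fin U :=
  if s.collided then d else s.rank

/-- The channel sensed by a user in the slot of index `k`, i.e. after `k` slots. In the first `C`
slots the channels are sensed once each, in the order `π`; from then on the user senses the channel
whose `g^MEAN` statistic has the rank of the user. Here `s` is the state of the user after
`k` slots, `d` its fresh rank and `σ` its ranking rule. -/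
def channel (hUC : U ≤ C) (σ : (Fin C → ℝ) → Equiv.Perm (Fin C)) (π : Equiv.Perm (Fin C))
    (k : ℕ) (s : UserState U C) (d : Fin U) : Fin C :=
  if h : k < C then π ⟨k, h⟩
  else σ (gMean s k) (Fin.castLE hUC (nextRank s d))

/-- State of user `j` after the slot of index `k`, from its state `s` before, the availabilities `w`
in this slot, the fresh rank `d`, and the channels `a` sensed by all users in this slot. A user
transmits iff its channel is free; there is a collision iff another user senses (hence
also transmits on) the same channel. Collisions in the first `C` slots are not recorded. -/
def nextState (k : ℕ) (w : Fin C → Bool) (a : Fin U → Fin C) (j : Fin U)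
    (s : UserState U C) (d : Fin U) : UserState U C where
  rank := if k < C then s.rank else nextRank s d
  sensed := fun i => s.sensed i + if a j = i then 1 else 0
  free := fun i => s.free i + if a j = i ∧ w i = true then 1 else 0
  collided := open Classical in decide (C ≤ k ∧ w (a j) = true ∧ ¬ Alone a j)

/-- The states of all users after `k` slots when every user runs the random allocation policy with
`U` users, `C` channels and the statistic `g^MEAN`. All users start with the highest rank. -/
def states (hUC : U ≤ C) (σ : Fin U → (Fin C → ℝ) → Equiv.Perm (Fin C))
    (π : Fin U → Equiv.Perm (Fin C)) (ω : Outcome U C) : ℕ → Fin U → UserState U C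
  | 0 => fun _ => { rank := 0, sensed := fun _ => 0, free := fun _ => 0, collided := false }
  | k + 1 => fun j =>
      nextState k (ω k).1
        (fun j' => channel hUC (σ j') (π j') k (states hUC σ π ω k j') ((ω k).2 j')) j
        (states hUC σ π ω k j) ((ω k).2 j)

/-- The channels sensed by the users in the slot of index `k`. -/
def sensedChannels (hUC : U ≤ C) (σ : Fin U → (Fin C → ℝ) → Equiv.Perm (Fin C))
    (π : Fin U → Equiv.Perm (Fin C)) (ω : Outcome U C) (k : ℕ) (j : Fin U) : Fin C :=
  channel hUC (σ j) (π j) k (states hUC σ π ω k j) ((ω k).2 j)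

open Classical in
/-- The total number of successful transmissions of all users in the first `n` slots: user `j` is
successful iff its channel is free and no other user is on it. -/
def successes (hUC : U ≤ C) (σ : Fin U → (Fin C → ℝ) → Equiv.Perm (Fin C))
    (π : Fin U → Equiv.Perm (Fin C)) (n : ℕ) (ω : Outcome U C) : ℝ :=
  ∑ k ∈ Finset.range n, ∑ j : Fin U,
    if (ω k).1 (sensedChannels hUC σ π ω k j) = true ∧ Alone (sensedChannels hUC σ π ω k) j
    then 1 else 0

/-- The sum regret after `n` slots: the expected number of successes when a central agent who knows
`μ` assigns the users to the `U` best channels, minus the expected number of successes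
of the random allocation policy. -/
def regret (hUC : U ≤ C) (μ : Fin C → unitInterval) (σ : Fin U → (Fin C → ℝ) → Equiv.Perm (Fin C))
    (π : Fin U → Equiv.Perm (Fin C)) (n : ℕ) : ℝ :=
  n * ∑ T : Fin U, (μ (bestChannel μ (Fin.castLE hUC T)) : ℝ)
    - ∫ ω, successes hUC σ π n ω ∂(law U μ)

end Policy

end RandAlloc

end

/-! Upper bound. Fix a horizon `n` and a threshold `M` of order `log n`. A slot is `Regular` if all
sample means lie within their confidence radii and every user senses a channel that it has already
sensed `M` times. The expected number of irregular slots is `O(log n)`: confidence failures are rare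
by Hoeffding's inequality (`integral_not_confident_le`), and each user can sense a given
under-explored channel at most `M` times (`sum_ind_sensed_lt_le`).

In a regular slot all users are on the `U` best channels, though a user of rank `r` need not be on
the `r`-th best one, because under-explored channels may inflate the ranking. What matters is
stability: between consecutive regular slots every statistic moves by at most `ε`, while means are
more than `2 * ε` apart, so a user that keeps its rank keeps its channel (`channels_nextStates_eq`).
Hence orthogonal configurations persist. From any other configuration with all channels free, some
vector of fresh ranks leads to an orthogonal configuration or to an irregular slot
(`exists_fresh_orthogonal`), and it is drawn with probability `U ^ (-U)`. The resulting contraction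
bounds the regular non-orthogonal slots by the irregular ones.

Lower bound. Raise the mean of a channel `i` outside the best `U` above all others. The upper bound
holds in the new model too, so there `i` is rarely visited fewer than a small multiple of `log n`
times. Likelihood ratios are at most exponential in the number of visited slots
(`integral_visits_le`), so few visits are also unlikely in the original model, where each visit
costs a fixed amount. -/

namespace RandAlloc

/-! ### Finite-horizon probability: marginals and independence of slots. -/

section Probability

variable {U C : ℕ}

/-- Probability of the outcome `b` of a Bernoulli variable with parameter `p`. -/
def bernWeight (p : ℝ) (b : Bool) : ℝ := if b then p else 1 - p

/-- Probability of the vector `w` of availabilities. -/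
def freeWeight (μ : Fin C → unitInterval) (w : Fin C → Bool) : ℝ :=
  ∏ i, bernWeight (μ i) (w i)

lemma bernWeight_nonneg (p : unitInterval) (b : Bool) : 0 ≤ bernWeight p b := by
  unfold bernWeight
  split_ifs
  · exact p.2.1
  · linarith [p.2.2]

lemma sum_freeWeight_mul_apply (μ : Fin C → unitInterval) (i : Fin C) (φ : Bool → ℝ) :
    ∑ w, freeWeight μ w * φ (w i) = μ i * φ true + (1 - μ i) * φ false := by
  classical
  -- Absorbing `φ` into the factor of index `i` turns the sum over vectors into a product of
  -- one-coordinate sums, all equal to `1` except the `i`-th.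
  have h : ∀ w : Fin C → Bool, freeWeight μ w * φ (w i)
      = ∏ l, (bernWeight (μ l) (w l) * if l = i then φ (w l) else 1) := by
    intro w
    rw [Finset.prod_mul_distrib, Finset.prod_ite_eq' Finset.univ i fun l => φ (w l)]
    simp [freeWeight]
  simp_rw [h]
  rw [← Fintype.prod_sum fun l b => bernWeight (μ l) b * if l = i then φ b else 1]
  rw [Finset.prod_eq_single i]
  · simp [bernWeight]
  · intro l _ hl
    simp [bernWeight, hl]
  · simp

lemma sum_freeWeight (μ : Fin C → unitInterval) : ∑ w, freeWeight μ w = 1 := by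
  have := Fintype.prod_sum fun (l : Fin C) b => bernWeight (μ l) b
  simp only [Fintype.sum_bool, bernWeight] at this
  simpa [freeWeight, bernWeight] using this.symm

lemma dependsOn_slot {α : Type*} {n : ℕ} {F : Outcome U C → SlotInput U C → α}
    (hF : ∀ x, DependsOn (fun ω => F ω x) (Set.Iio n)) :
    DependsOn (fun ω => F ω (ω n)) (Set.Iio (n + 1)) := fun ω ω' h => by
  have e : F ω (ω n) = F ω' (ω n) := hF _ fun k hk => h k (Set.mem_Iio.2 (Nat.lt_succ_of_lt hk))
  have e' : ω n = ω' n := h n (Set.mem_Iio.2 (Nat.lt_succ_self n))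
  exact e.trans (congrArg _ e')

variable [NeZero U]

lemma slotLaw_real_singleton (μ : Fin C → unitInterval) (x : SlotInput U C) :
    (slotLaw U μ).real {x} = freeWeight μ x.1 * ((U : ℝ)⁻¹) ^ U := by
  obtain ⟨w, d⟩ := x
  rw [← Set.singleton_prod_singleton, slotLaw, measureReal_prod_prod]
  congr 1
  · rw [measureReal_def, Measure.pi_singleton, ENNReal.toReal_prod, freeWeight]
    refine Finset.prod_congr rfl fun i _ => ?_
    rw [← measureReal_def]
    rw [bernoulliMeasure_real_apply _ (MeasurableSet.singleton _)]
    cases h : w i <;> simp [bernWeight, h]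
  · rw [measureReal_def, Measure.pi_singleton, ENNReal.toReal_prod]
    simp [uniformOn_univ]

/-- The first `n` slots have only finitely many possible values, so no measurability or boundedness
needs to be checked. -/
lemma integrable_of_dependsOn (μ : Fin C → unitInterval) {n : ℕ} {f : Outcome U C → ℝ}
    (hf : DependsOn f (Set.Iio n)) : Integrable f (law U μ) := by
  obtain ⟨g, rfl⟩ := dependsOn_iff_exists_comp.1 hf
  have : Integrable g ((law U μ).map ((Set.Iio n).domRestrict)) := by
    have : IsFiniteMeasure (Measure.map ((Set.Iio n).domRestrict) (law U μ)) := by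
      unfold law; infer_instance
    exact Integrable.of_finite
  exact this.comp_measurable (by fun_prop)

/-- The input of slot `n` is independent of the earlier slots. -/
lemma integral_step (μ : Fin C → unitInterval) {n : ℕ} {F : Outcome U C → SlotInput U C → ℝ}
    (hF : ∀ x, DependsOn (fun ω => F ω x) (Set.Iio n)) :
    ∫ ω, F ω (ω n) ∂law U μ
      = ∫ ω, ∑ x, (slotLaw U μ).real {x} * F ω x ∂law U μ := by
  classical
  have hint : ∀ x, Integrable (fun ω => F ω x) (law U μ) := fun x =>
    integrable_of_dependsOn μ (hF x)
  have h1 : ∀ ω : Outcome U C, F ω (ω n) = ∑ x, F ω x * (if ω n = x then 1 else 0) := by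
    intro ω; simp
  have hind : ∀ x, IndepFun (fun ω : Outcome U C => F ω x)
      (fun ω => if ω n = x then (1 : ℝ) else 0) (law U μ) := by
    intro x
    obtain ⟨g, hg⟩ := dependsOn_iff_exists_comp.1 (hF x)
    have h := (iIndepFun_infinitePi (P := fun _ : ℕ => slotLaw U μ) (X := fun _ x => x)
      (fun _ => measurable_id)).indepFun_finset (Finset.range n) {n} (by simp)
      (fun i => measurable_pi_apply i)
    let φ : ((i : Finset.range n) → SlotInput U C) → ℝ := fun y =>
      g fun i : Set.Iio n => y ⟨i.1, Finset.mem_range.2 i.2⟩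
    let ψ : ((i : ({n} : Finset ℕ)) → SlotInput U C) → ℝ := fun y =>
      if y ⟨n, by simp⟩ = x then 1 else 0
    have := h.comp (φ := φ) (ψ := ψ) .of_discrete .of_discrete
    rw [hg]
    exact this
  have hs : ∀ x, MeasurableSet {ω : Outcome U C | ω n = x} := fun x =>
    measurableSet_eq_fun (measurable_pi_apply n) measurable_const
  simp_rw [h1]
  rw [integral_finsetSum, integral_finsetSum]
  · refine Finset.sum_congr rfl fun x _ => ?_
    rw [(hind x).integral_fun_mul_eq_mul_integral (hint x).aestronglyMeasurable
      (Measurable.ite (hs x) measurable_const measurable_const).aestronglyMeasurable]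
    rw [integral_const_mul, mul_comm]
    congr 1
    have : (fun ω : Outcome U C => if ω n = x then (1 : ℝ) else 0)
        = Set.indicator {ω | ω n = x} 1 := by
      ext ω; simp [Set.indicator]
    rw [this, integral_indicator_one (hs x)]
    rw [← Measure.infinitePi_map_eval (fun _ : ℕ => slotLaw U μ) n, measureReal_def,
      measureReal_def, Measure.map_apply (measurable_pi_apply n) (MeasurableSet.singleton x)]
    rfl
  · exact fun x _ => (hint x).const_mul _
  · intro x _
    exact integrable_of_dependsOn μ (dependsOn_slot
      (F := fun ω y => F ω x * if y = x then 1 else 0) fun y ω ω' h => by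
        simp only [show F ω x = F ω' x from hF x h])

lemma sum_slotLaw (μ : Fin C → unitInterval) (f : SlotInput U C → ℝ) :
    ∑ x, (slotLaw U μ).real {x} * f x
      = ∑ d : Fin U → Fin U, ((U : ℝ)⁻¹) ^ U * ∑ w, freeWeight μ w * f (w, d) := by
  simp_rw [slotLaw_real_singleton, Fintype.sum_prod_type_right, Finset.mul_sum]
  exact Finset.sum_congr rfl fun d _ => Finset.sum_congr rfl fun w _ => by ring

/-- The availabilities in slot `n` are independent of the earlier slots and of the fresh ranks. -/
lemma integral_mul_free (μ : Fin C → unitInterval) {n : ℕ}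
    {F : Outcome U C → (Fin U → Fin U) → ℝ} (hF : ∀ d, DependsOn (fun ω => F ω d) (Set.Iio n))
    (h : (Fin C → Bool) → ℝ) :
    ∫ ω, F ω (ω n).2 * h (ω n).1 ∂law U μ
      = (∑ w, freeWeight μ w * h w) * ∫ ω, F ω (ω n).2 ∂law U μ := by
  rw [integral_step μ (F := fun ω x => F ω x.2 * h x.1), integral_step μ (F := fun ω x => F ω x.2),
    ← integral_const_mul]
  · refine integral_congr_ae (Filter.Eventually.of_forall fun ω => ?_)
    simp only [sum_slotLaw]
    rw [Finset.mul_sum]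
    refine Finset.sum_congr rfl fun d _ => ?_
    simp_rw [← Finset.sum_mul, sum_freeWeight]
    simp_rw [mul_left_comm _ (F ω d), ← Finset.mul_sum]
    ring
  · exact fun x => hF x.2
  · intro x ω ω' hω
    simp only [hF x.2 hω]

/-- The fresh ranks of slot `n` take every value with the same probability, given the past. -/
lemma integral_mul_fresh (μ : Fin C → unitInterval) {n : ℕ} {f : Outcome U C → ℝ}
    {d : Outcome U C → Fin U → Fin U} (hf : DependsOn f (Set.Iio n))
    (hd : DependsOn d (Set.Iio n)) :
    ∫ ω, f ω * (if (ω n).2 = d ω then 1 else 0) ∂law U μ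
      = ((U : ℝ)⁻¹) ^ U * ∫ ω, f ω ∂law U μ := by
  rw [integral_step μ (F := fun ω x => f ω * if x.2 = d ω then 1 else 0), ← integral_const_mul]
  · refine integral_congr_ae (Filter.Eventually.of_forall fun ω => ?_)
    beta_reduce
    rw [sum_slotLaw]
    simp [← Finset.sum_mul, sum_freeWeight]
  · intro x ω ω' hω
    simp only [hf hω, hd hω]

end Probability

/-! ### Order statistics and the set of best channels. -/

section Ranking

variable {C : ℕ}

/-- Order statistics are monotone, and `1`-Lipschitz for the supremum norm. -/
lemma apply_rank_le {v v' : Fin C → ℝ} {p p' : Equiv.Perm (Fin C)} (hp : Antitone (v ∘ p))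
    (hp' : Antitone (v' ∘ p')) {ε : ℝ} (h : ∀ m, v m ≤ v' m + ε) (r : Fin C) :
    v (p r) ≤ v' (p' r) + ε := by
  -- Pigeonhole: the channels placed up to `r` by `p` are one more than those placed strictly before
  -- `r` by `p'`, so one of them is placed at `r` or later by `p'`.
  obtain ⟨m, hm, hm'⟩ : ∃ m ∈ (Finset.Iic r).map p.toEmbedding,
      m ∉ (Finset.Iio r).map p'.toEmbedding := by
    apply Finset.exists_mem_notMem_of_card_lt_card
    simp
  obtain ⟨s, hs, rfl⟩ := Finset.mem_map.1 hm
  have ht : r ≤ p'.symm (p s) := by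
    by_contra hlt
    exact hm' (Finset.mem_map.2 ⟨p'.symm (p s), Finset.mem_Iio.2 (not_le.1 hlt), by simp⟩)
  have h1 : v (p r) ≤ v (p s) := hp (Finset.mem_Iic.1 hs)
  have h2 : v' (p s) ≤ v' (p' r) := by simpa using hp' ht
  exact h1.trans ((h _).trans (by simpa using h2))

lemma antitone_bestChannel (μ : Fin C → unitInterval) :
    Antitone ((fun i => (μ i : ℝ)) ∘ bestChannel μ) := fun i j hij => by
  have := Tuple.monotone_sort (fun i => -(μ i : ℝ)) hij
  simpa [bestChannel] using this

/-- The set of the `U` channels with the highest mean availabilities. -/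
noncomputable def topChannels {U : ℕ} (hUC : U ≤ C) (μ : Fin C → unitInterval) : Finset (Fin C) :=
  Finset.univ.image fun T : Fin U => bestChannel μ (Fin.castLE hUC T)

lemma injective_bestChannel_castLE {U : ℕ} (hUC : U ≤ C) (μ : Fin C → unitInterval) :
    Function.Injective fun T : Fin U => bestChannel μ (Fin.castLE hUC T) :=
  (bestChannel μ).injective.comp (Fin.castLE_injective hUC)

lemma card_topChannels {U : ℕ} (hUC : U ≤ C) (μ : Fin C → unitInterval) :
    (topChannels hUC μ).card = U := by
  rw [topChannels, Finset.card_image_of_injective _ (injective_bestChannel_castLE hUC μ)]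
  simp

/-- All means differ by more than `2 * ε`. -/
def Separated (μ : Fin C → unitInterval) (ε : ℝ) : Prop :=
  ∀ i i', i ≠ i' → 2 * ε < |(μ i : ℝ) - μ i'|

lemma exists_separated {μ : Fin C → unitInterval} (hμ : Function.Injective μ) :
    ∃ ε, 0 < ε ∧ Separated μ ε := by
  have h : ∀ᶠ ε in nhdsWithin (0 : ℝ) (Set.Ioi 0), ∀ i i', i ≠ i' →
      2 * ε < |(μ i : ℝ) - μ i'| := by
    simp only [Filter.eventually_all]
    intro i i' hi
    have hpos : 0 < |(μ i : ℝ) - μ i'| :=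
      abs_pos.2 (sub_ne_zero.2 fun e => hi (hμ (Subtype.ext e)))
    have : ∀ᶠ ε in nhds (0 : ℝ), 2 * ε < |(μ i : ℝ) - μ i'| :=
      (continuous_const.mul continuous_id).continuousAt.eventually_lt_const (by simpa using hpos)
    exact this.filter_mono nhdsWithin_le_nhds
  obtain ⟨ε, h1, h2⟩ := (h.and self_mem_nhdsWithin).exists
  exact ⟨ε, h2, h1⟩

/-- If all statistics are at least the true means, then a channel of rank at most `U` whose
statistic does not exceed its mean by much is one of the `U` best channels. -/
lemma mem_topChannels {U : ℕ} (hUC : U ≤ C) {μ : Fin C → unitInterval} {ε : ℝ} (hε : 0 < ε)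
    (hμ : Separated μ ε) {g : Fin C → ℝ} {p : Equiv.Perm (Fin C)} (hp : Antitone (g ∘ p))
    (hg : ∀ m, (μ m : ℝ) ≤ g m) (r : Fin U)
    (hr : g (p (Fin.castLE hUC r)) ≤ μ (p (Fin.castLE hUC r)) + ε) :
    p (Fin.castLE hUC r) ∈ topChannels hUC μ := by
  set i := p (Fin.castLE hUC r)
  -- The `r`-th highest statistic is at least the `r`-th highest mean. A channel outside the best
  -- set has a mean more than `2 * ε` below that one, too low for its statistic to reach it.
  have h1 : (μ (bestChannel μ (Fin.castLE hUC r)) : ℝ) ≤ g i + 0 :=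
    apply_rank_le (antitone_bestChannel μ) hp (by simpa using hg) _
  by_cases hT : ((bestChannel μ).symm i : ℕ) < U
  · exact Finset.mem_image.2 ⟨⟨_, hT⟩, Finset.mem_univ _, by simp⟩
  · have hlt : Fin.castLE hUC r < (bestChannel μ).symm i := by
      rw [Fin.lt_def]
      simp only [Fin.val_castLE]
      omega
    have h2 : (μ i : ℝ) ≤ μ (bestChannel μ (Fin.castLE hUC r)) := by
      simpa using antitone_bestChannel μ hlt.le
    have h3 := hμ i (bestChannel μ (Fin.castLE hUC r)) (by
      intro e
      have := congrArg (bestChannel μ).symm e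
      simp only [Equiv.symm_apply_apply] at this
      exact hlt.ne this.symm)
    rw [abs_sub_comm, abs_of_nonneg (by linarith)] at h3
    linarith

end Ranking

/-! ### Confidence intervals and the slow growth of their radii. -/

section Confidence

variable {U C : ℕ}

/-- All sample means are as close to the true means as the `g^MEAN` statistic presumes. -/
def Confident (μ : Fin C → unitInterval) (k : ℕ) (s : Fin U → UserState U C) : Prop :=
  ∀ j i, |((s j).free i : ℝ) / (s j).sensed i - μ i| ≤ Real.sqrt (2 * Real.log k / (s j).sensed i)

variable {μ : Fin C → unitInterval}

lemma Confident.le_gMean {k : ℕ} {s : Fin U → UserState U C} (h : Confident μ k s)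
    (j : Fin U) (i : Fin C) : (μ i : ℝ) ≤ gMean (s j) k i := by
  have := (abs_le.1 (h j i)).1
  unfold gMean
  linarith

lemma Confident.gMean_le {k M : ℕ} {s : Fin U → UserState U C} (h : Confident μ k s) {ε : ℝ}
    (hε : 0 < ε) (hM : 8 * Real.log k ≤ ε ^ 2 * M) {j : Fin U} {i : Fin C}
    (hi : M ≤ (s j).sensed i) : gMean (s j) k i ≤ μ i + ε := by
  have h1 := (abs_le.1 (h j i)).2
  -- The factor `8` makes the radius at most `ε / 2`; it is counted twice, once in the sample mean
  -- and once in the bonus.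
  have h2 : Real.sqrt (2 * Real.log k / (s j).sensed i) ≤ ε / 2 := by
    refine Real.sqrt_le_iff.2 ⟨by positivity, ?_⟩
    rcases Nat.eq_zero_or_pos ((s j).sensed i) with h0 | h0
    · simp only [h0, Nat.cast_zero, div_zero]; positivity
    · have hp : (0 : ℝ) < (s j).sensed i := by exact_mod_cast h0
      have hi' : (M : ℝ) ≤ (s j).sensed i := by exact_mod_cast hi
      rw [div_le_iff₀ hp]
      have := mul_le_mul_of_nonneg_left hi' (sq_nonneg ε)
      nlinarith
  unfold gMean
  linarith

/-- Passing from `k` to `k + 1` raises the logarithm by at most `1 / k`, hence the radicand by at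
most `2 / k`, which is at most `ε ^ 2`. -/
lemma sqrt_log_succ_div_le {k T : ℕ} {ε : ℝ} (hε : 0 < ε) (hk : 2 ≤ ε ^ 2 * k) :
    Real.sqrt (2 * Real.log (k + 1 : ℕ) / T) ≤ Real.sqrt (2 * Real.log k / T) + ε := by
  have hk0 : (0 : ℝ) < k := by
    rcases Nat.eq_zero_or_pos k with rfl | h
    · norm_num at hk
    · exact_mod_cast h
  have h1k : (1 : ℝ) ≤ k := by exact_mod_cast (Nat.cast_pos.1 hk0)
  have hlog : Real.log (k + 1 : ℕ) ≤ Real.log k + 1 / k := by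
    have := Real.log_le_sub_one_of_pos (x := ((k + 1 : ℕ) : ℝ) / k) (by positivity)
    rw [Real.log_div (by positivity) (by positivity)] at this
    have e : (((k + 1 : ℕ) : ℝ)) / k - 1 = 1 / k := by push_cast; field_simp; ring
    linarith
  rcases Nat.eq_zero_or_pos T with rfl | hT
  · simp [hε.le]
  have hT' : (1 : ℝ) ≤ T := by exact_mod_cast hT
  have hl0 : 0 ≤ Real.log k := Real.log_nonneg h1k
  have hs := Real.sq_sqrt (show 0 ≤ 2 * Real.log k / T by positivity)
  refine Real.sqrt_le_iff.2 ⟨by positivity, ?_⟩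
  have h2 : 2 * Real.log (k + 1 : ℕ) / T ≤ 2 * Real.log k / T + ε ^ 2 := by
    have h3 : 2 * (1 / k : ℝ) ≤ ε ^ 2 := by
      rw [mul_one_div, div_le_iff₀ hk0]; exact hk
    have h4 : 2 * (1 / k : ℝ) / T ≤ 2 * (1 / k) := div_le_self (by positivity) hT'
    calc 2 * Real.log (k + 1 : ℕ) / T ≤ 2 * (Real.log k + 1 / k) / T := by gcongr
      _ = 2 * Real.log k / T + 2 * (1 / k) / T := by ring
      _ ≤ _ := by linarith
  have := mul_nonneg (Real.sqrt_nonneg (2 * Real.log k / T)) hε.le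
  nlinarith

end Confidence

/-! ### Deterministic behaviour of the policy between regular slots. -/

section Dynamics

variable {U C : ℕ} (hUC : U ≤ C) (μ : Fin C → unitInterval)
  (σ : Fin U → (Fin C → ℝ) → Equiv.Perm (Fin C)) (π : Fin U → Equiv.Perm (Fin C))

/-- The channels sensed in the slot of index `k`, from the states and the fresh ranks. -/
noncomputable def channels (k : ℕ) (s : Fin U → UserState U C) (d : Fin U → Fin U) : Fin U → Fin C :=
  fun j => channel hUC (σ j) (π j) k (s j) (d j)

/-- The states after the slot of index `k`, from the states before and the input of the slot. -/
noncomputable def nextStates (k : ℕ) (s : Fin U → UserState U C) (x : SlotInput U C) : Fin U → UserState U C :=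
  fun j => nextState k x.1 (channels hUC σ π k s x.2) j (s j) (x.2 j)

/-- The sample means are close to the true means and every user senses a channel that it has
sensed at least `M` times. -/
def Regular (M k : ℕ) (s : Fin U → UserState U C) (d : Fin U → Fin U) : Prop :=
  Confident μ k s ∧ ∀ j, M ≤ (s j).sensed (channels hUC σ π k s d j)

/-- The users sense different channels, all of them among the `U` best. -/
def Orthogonal (a : Fin U → Fin C) : Prop :=
  (∀ j, a j ∈ topChannels hUC μ) ∧ Function.Injective a

variable {hUC μ σ π}

/-- The statistics hardly change in a slot in which every user senses a well explored channel. -/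
lemma abs_gMean_nextStates_sub_le {M k : ℕ} {s : Fin U → UserState U C} {x : SlotInput U C} {ε : ℝ}
    (hε : 0 < ε) (hk : 2 ≤ ε ^ 2 * k) (hM : 8 * Real.log k ≤ ε ^ 2 * M)
    (hM' : 8 * Real.log (k + 1 : ℕ) ≤ ε ^ 2 * M) (h : Regular hUC μ σ π M k s x.2)
    (h' : Confident μ (k + 1) (nextStates hUC σ π k s x)) (j : Fin U) (m : Fin C) :
    |gMean (nextStates hUC σ π k s x j) (k + 1) m - gMean (s j) k m| ≤ ε := by
  -- A well explored channel has both statistics between its mean and its mean plus `ε`. Any other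
  -- channel was not sensed in this slot, so only the logarithm in its bonus changes.
  by_cases hm : M ≤ (s j).sensed m
  · have hm' : M ≤ (nextStates hUC σ π k s x j).sensed m := by
      simp only [nextStates, nextState]; omega
    have h1 := h.1.le_gMean j m
    have h2 := h'.le_gMean j m
    have h3 := h.1.gMean_le hε hM hm
    have h4 := h'.gMean_le hε hM' hm'
    rw [abs_le]; constructor <;> linarith
  · have hne : channels hUC σ π k s x.2 j ≠ m := by
      rintro rfl; exact hm (h.2 j)
    have h1 : Real.sqrt (2 * Real.log k / (s j).sensed m)
        ≤ Real.sqrt (2 * Real.log (k + 1 : ℕ) / (s j).sensed m) := by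
      have hk0 : (0 : ℝ) < k := by
        rcases Nat.eq_zero_or_pos k with rfl | h
        · norm_num at hk
        · exact_mod_cast h
      gcongr
      omega
    have h2 := sqrt_log_succ_div_le (T := (s j).sensed m) hε hk
    simp only [gMean, nextStates, nextState, hne, false_and, if_false, add_zero]
    rw [abs_le]; constructor <;> linarith

lemma Regular.mem_topChannels {M k : ℕ} {s : Fin U → UserState U C} {d : Fin U → Fin U} {ε : ℝ}
    (hσ : ∀ j, IsRankingRule (σ j)) (hε : 0 < ε) (hμ : Separated μ ε) (hC : C ≤ k)
    (hM : 8 * Real.log k ≤ ε ^ 2 * M) (h : Regular hUC μ σ π M k s d) (j : Fin U) :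
    channels hUC σ π k s d j ∈ topChannels hUC μ := by
  have h2 := h.1.gMean_le hε hM (h.2 j)
  simp only [channels, channel, dif_neg (not_lt.2 hC)] at h2 ⊢
  exact RandAlloc.mem_topChannels hUC hε hμ (hσ j _) (h.1.le_gMean j) _ h2

/-- A user without a collision stays on its channel between regular slots. -/
lemma channels_nextStates_eq {M k : ℕ} {s : Fin U → UserState U C} {x : SlotInput U C}
    {d : Fin U → Fin U} {ε : ℝ} (hσ : ∀ j, IsRankingRule (σ j)) (hε : 0 < ε) (hμ : Separated μ ε)
    (hC : C ≤ k) (hk : 2 ≤ ε ^ 2 * k) (hM : 8 * Real.log k ≤ ε ^ 2 * M)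
    (hM' : 8 * Real.log (k + 1 : ℕ) ≤ ε ^ 2 * M) (h : Regular hUC μ σ π M k s x.2)
    (h' : Regular hUC μ σ π M (k + 1) (nextStates hUC σ π k s x) d) {j : Fin U}
    (hj : Alone (channels hUC σ π k s x.2) j) :
    channels hUC σ π (k + 1) (nextStates hUC σ π k s x) d j = channels hUC σ π k s x.2 j := by
  have hC' : ¬ k + 1 < C := by omega
  have hstep := abs_gMean_nextStates_sub_le hε hk hM hM' h h'.1 j
  have hr : nextRank (nextStates hUC σ π k s x j) (d j) = nextRank (s j) (x.2 j) := by
    simp [nextRank, nextStates, nextState, hj, hC]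
  have g1 := h.1.le_gMean j (channels hUC σ π k s x.2 j)
  have g2 := h.1.gMean_le hε hM (h.2 j)
  have g1' := h'.1.le_gMean j (channels hUC σ π (k + 1) (nextStates hUC σ π k s x) d j)
  have g2' := h'.1.gMean_le hε hM' (h'.2 j)
  have a1 := apply_rank_le (hσ j (gMean (s j) k))
    (hσ j (gMean (nextStates hUC σ π k s x j) (k + 1))) (ε := ε)
    (fun m => by have := (abs_le.1 (hstep m)).1; linarith)
    (Fin.castLE hUC (nextRank (s j) (x.2 j)))
  have a2 := apply_rank_le (hσ j (gMean (nextStates hUC σ π k s x j) (k + 1)))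
    (hσ j (gMean (s j) k)) (ε := ε)
    (fun m => by have := (abs_le.1 (hstep m)).2; linarith)
    (Fin.castLE hUC (nextRank (s j) (x.2 j)))
  -- The statistics of the old and the new channel differ by at most `ε`, and each lies between the
  -- respective mean and that mean plus `ε`. So the two means differ by at most `2 * ε`, against
  -- separation.
  by_contra hne
  have hsep := hμ _ _ hne
  have e1 : channels hUC σ π k s x.2 j
      = σ j (gMean (s j) k) (Fin.castLE hUC (nextRank (s j) (x.2 j))) := by
    simp [channels, channel, not_lt.2 hC]
  have e2 : channels hUC σ π (k + 1) (nextStates hUC σ π k s x) d j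
      = σ j (gMean (nextStates hUC σ π k s x j) (k + 1))
        (Fin.castLE hUC (nextRank (s j) (x.2 j))) := by
    simp [channels, channel, hC', hr]
  rw [← e1, ← e2] at a1 a2
  rw [lt_abs] at hsep
  rcases hsep with hsep | hsep <;> linarith

/-- An orthogonal configuration lasts as long as the slots are regular. -/
lemma Orthogonal.nextStates {M k : ℕ} {s : Fin U → UserState U C} {x : SlotInput U C}
    {d : Fin U → Fin U} {ε : ℝ} (hσ : ∀ j, IsRankingRule (σ j)) (hε : 0 < ε) (hμ : Separated μ ε)
    (hC : C ≤ k) (hk : 2 ≤ ε ^ 2 * k) (hM : 8 * Real.log k ≤ ε ^ 2 * M)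
    (hM' : 8 * Real.log (k + 1 : ℕ) ≤ ε ^ 2 * M) (h : Regular hUC μ σ π M k s x.2)
    (h' : Regular hUC μ σ π M (k + 1) (nextStates hUC σ π k s x) d)
    (ho : Orthogonal hUC μ (channels hUC σ π k s x.2)) :
    Orthogonal hUC μ (channels hUC σ π (k + 1) (RandAlloc.nextStates hUC σ π k s x) d) := by
  have : channels hUC σ π (k + 1) (RandAlloc.nextStates hUC σ π k s x) d
      = channels hUC σ π k s x.2 := by
    funext j
    exact channels_nextStates_eq hσ hε hμ hC hk hM hM' h h' fun j' hj' => ho.2 hj'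
  rwa [this]

/-- If all channels are free in a regular slot, then some values of the fresh ranks
make the configuration orthogonal or the next slot irregular. -/
lemma exists_fresh_orthogonal [NeZero U] {M k : ℕ} {s : Fin U → UserState U C} {x : SlotInput U C} {ε : ℝ}
    (hσ : ∀ j, IsRankingRule (σ j)) (hε : 0 < ε) (hμ : Separated μ ε)
    (hC : C ≤ k) (hk : 2 ≤ ε ^ 2 * k) (hM : 8 * Real.log k ≤ ε ^ 2 * M)
    (hM' : 8 * Real.log (k + 1 : ℕ) ≤ ε ^ 2 * M) (h : Regular hUC μ σ π M k s x.2)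
    (hx : ∀ i, x.1 i = true) :
    ∃ d, Regular hUC μ σ π M (k + 1) (nextStates hUC σ π k s x) d →
      Orthogonal hUC μ (channels hUC σ π (k + 1) (nextStates hUC σ π k s x) d) := by
  classical
  set s' := nextStates hUC σ π k s x with hs'
  set a := channels hUC σ π k s x.2 with ha
  have hC' : ¬ k + 1 < C := by omega
  have hchan : ∀ d j, ¬ Alone a j →
      channels hUC σ π (k + 1) s' d j = σ j (gMean (s' j) (k + 1)) (Fin.castLE hUC (d j)) := by
    intro d j hj
    have : (s' j).collided = true := by simp [hs', nextStates, nextState, hC, hx, ← ha, hj]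
    simp [channels, channel, hC', nextRank, this]
  by_cases hg : Confident μ (k + 1) s'
  swap
  · exact ⟨fun _ => 0, fun h' => absurd h'.1 hg⟩
  -- If some rank sends a colliding user to an under-explored channel, drawing this rank makes the
  -- next slot irregular.
  by_cases hcase : ∃ j, ¬ Alone a j ∧ ∃ T : Fin U,
      (s' j).sensed (σ j (gMean (s' j) (k + 1)) (Fin.castLE hUC T)) < M
  · obtain ⟨j, hj, T, hT⟩ := hcase
    refine ⟨fun _ => T, fun h' => ?_⟩
    have := h'.2 j
    rw [hchan _ _ hj] at this
    omega
  push Not at hcase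
  -- Otherwise the `U` ranks of a colliding user give `U` distinct channels inside the best set,
  -- hence all of it.
  have htop : ∀ j, ¬ Alone a j → ∀ i ∈ topChannels hUC μ, ∃ T : Fin U,
      σ j (gMean (s' j) (k + 1)) (Fin.castLE hUC T) = i := by
    intro j hj
    have hsub : Finset.univ.image
        (fun T : Fin U => σ j (gMean (s' j) (k + 1)) (Fin.castLE hUC T)) = topChannels hUC μ := by
      refine Finset.eq_of_subset_of_card_le ?_ ?_
      · intro i hi
        obtain ⟨T, -, rfl⟩ := Finset.mem_image.1 hi
        exact mem_topChannels hUC hε hμ (hσ j _) (hg.le_gMean j) _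
          (hg.gMean_le hε hM' (hcase j hj T))
      · rw [card_topChannels, Finset.card_image_of_injective]
        · simp
        · exact (σ j _).injective.comp (Fin.castLE_injective hUC)
    intro i hi
    rw [← hsub] at hi
    obtain ⟨T, -, hT⟩ := Finset.mem_image.1 hi
    exact ⟨T, hT⟩
  -- The users without collision already occupy distinct best channels and will stay there.
  -- Extending their placement to a bijection tells every other user where to go.
  obtain ⟨e, he⟩ := Finset.exists_equiv_extend_of_card_eq (t := topChannels hUC μ)
    (s := Finset.univ.filter (Alone a)) (f := a) (by simp [card_topChannels])
    (fun i hi => by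
      obtain ⟨j, -, rfl⟩ := Finset.mem_image.1 hi
      exact h.mem_topChannels hσ hε hμ hC hM j)
    (fun j hj j' hj' hjj' => ((Finset.mem_filter.1 hj').2 j hjj'))
  have hT : ∀ j, ∃ T : Fin U, ¬ Alone a j →
      σ j (gMean (s' j) (k + 1)) (Fin.castLE hUC T) = e j := by
    intro j
    by_cases hj : Alone a j
    · exact ⟨0, fun h => absurd hj h⟩
    · obtain ⟨T, hT⟩ := htop j hj (e j) (e j).2
      exact ⟨T, fun _ => hT⟩
  choose d hd using hT
  refine ⟨d, fun h' => ?_⟩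
  have key : channels hUC σ π (k + 1) s' d = fun j => (e j : Fin C) := by
    funext j
    by_cases hj : Alone a j
    · rw [channels_nextStates_eq hσ hε hμ hC hk hM hM' h h' hj, he j (by simpa using hj)]
    · rw [hchan d j hj, hd j hj]
  rw [key]
  exact ⟨fun j => (e j).2, Subtype.val_injective.comp e.injective⟩

end Dynamics

/-! ### States as functions of the past slots. -/

section States

variable {U C : ℕ} [NeZero U] (hUC : U ≤ C)
  (σ : Fin U → (Fin C → ℝ) → Equiv.Perm (Fin C)) (π : Fin U → Equiv.Perm (Fin C))

lemma states_succ (ω : Outcome U C) (k : ℕ) :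
    states hUC σ π ω (k + 1) = nextStates hUC σ π k (states hUC σ π ω k) (ω k) := rfl

lemma sensedChannels_eq (ω : Outcome U C) (k : ℕ) :
    sensedChannels hUC σ π ω k = channels hUC σ π k (states hUC σ π ω k) (ω k).2 := rfl

lemma dependsOn_states (k : ℕ) :
    DependsOn (fun ω => states hUC σ π ω k) (Set.Iio k) := by
  induction k with
  | zero => intro ω ω' _; rfl
  | succ k ih =>
    intro ω ω' h
    have h1 := ih fun i hi => h i (Set.mem_Iio.2 (Nat.lt_succ_of_lt hi))
    simp only [states_succ] at h1 ⊢
    rw [h1, h k (Set.mem_Iio.2 (Nat.lt_succ_self k))]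

end States

section Indicator

/-- The indicator of a proposition, as a real number. -/
noncomputable def ind (p : Prop) : ℝ := open Classical in if p then 1 else 0

lemma ind_of_true {p : Prop} (h : p) : ind p = 1 := if_pos h

lemma ind_of_false {p : Prop} (h : ¬ p) : ind p = 0 := if_neg h

lemma ind_nonneg (p : Prop) : 0 ≤ ind p := by
  by_cases h : p
  · simp [ind_of_true h]
  · simp [ind_of_false h]

lemma ind_le_one (p : Prop) : ind p ≤ 1 := by
  by_cases h : p
  · simp [ind_of_true h]
  · simp [ind_of_false h]

lemma ind_le {p : Prop} {x : ℝ} (h0 : 0 ≤ x) (h : p → 1 ≤ x) : ind p ≤ x := by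
  by_cases hp : p
  · simpa [ind_of_true hp] using h hp
  · simpa [ind_of_false hp] using h0

end Indicator

/-- Hoeffding's lemma for a variable in `[0, 1]`, written so that it gives one supermartingale step
of `expDev`. -/
lemma bernoulli_mgf_le (p : unitInterval) (l : ℝ) :
    (p : ℝ) * Real.exp (l * (1 - p) - l ^ 2 / 8) + (1 - p) * Real.exp (l * (0 - p) - l ^ 2 / 8)
      ≤ 1 := by
  have hb : ∀ᵐ x ∂(bernoulliMeasure (1 : ℝ) 0 p), id x ∈ Set.Icc (0 : ℝ) 1 := by
    rw [bernoulliMeasure_def, ae_add_measure_iff]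
    constructor <;> refine Measure.ae_smul_measure ?_ _ <;> simp
  have h := (hasSubgaussianMGF_of_mem_Icc (μ := bernoulliMeasure (1 : ℝ) 0 p)
    measurable_id.aemeasurable hb).mgf_le l
  simp only [mgf, integral_bernoulliMeasure, id] at h
  simp only [smul_eq_mul, mul_one, mul_zero, add_zero] at h
  have e : (((‖(1 : ℝ) - 0‖₊ / 2) ^ 2 : NNReal) : ℝ) * l ^ 2 / 2 = l ^ 2 / 8 := by
    push_cast
    norm_num
    ring
  rw [e] at h
  rw [Real.exp_sub, Real.exp_sub, ← mul_div_assoc, ← mul_div_assoc, ← add_div,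
    div_le_one (Real.exp_pos _)]
  exact h

/-! ### Counting how often channels are sensed. -/

section Counting

variable {U C : ℕ} [NeZero U] {hUC : U ≤ C} {μ : Fin C → unitInterval}
  {σ : Fin U → (Fin C → ℝ) → Equiv.Perm (Fin C)} {π : Fin U → Equiv.Perm (Fin C)}

lemma sensed_succ (ω : Outcome U C) (k : ℕ) (j : Fin U) (i : Fin C) :
    (states hUC σ π ω (k + 1) j).sensed i = (states hUC σ π ω k j).sensed i
      + if sensedChannels hUC σ π ω k j = i then 1 else 0 := rfl

lemma free_succ (ω : Outcome U C) (k : ℕ) (j : Fin U) (i : Fin C) :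
    (states hUC σ π ω (k + 1) j).free i = (states hUC σ π ω k j).free i
      + if sensedChannels hUC σ π ω k j = i ∧ (ω k).1 i = true then 1 else 0 := rfl

lemma sensed_mono (ω : Outcome U C) (j : Fin U) (i : Fin C) :
    Monotone fun k => (states hUC σ π ω k j).sensed i :=
  monotone_nat_of_le_succ fun k => by rw [sensed_succ]; omega

lemma sensed_le (ω : Outcome U C) (k : ℕ) (j : Fin U) (i : Fin C) :
    (states hUC σ π ω k j).sensed i ≤ k := by
  induction k with
  | zero => exact le_rfl
  | succ k ih => rw [sensed_succ]; split_ifs <;> omega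

lemma one_le_sensed (ω : Outcome U C) {k : ℕ} (hk : C ≤ k) (j : Fin U) (i : Fin C) :
    1 ≤ (states hUC σ π ω k j).sensed i := by
  have hl : ((π j).symm i : ℕ) < C := ((π j).symm i).2
  refine le_trans ?_ (sensed_mono ω j i (show ((π j).symm i : ℕ) + 1 ≤ k by omega))
  have : sensedChannels hUC σ π ω ((π j).symm i) j = i := by
    simp [sensedChannels, channel]
  simp only [sensed_succ, this, if_true]
  omega

/-- A user senses channels that it has sensed less than `M` times in at most `C * M` slots. -/
lemma sum_ind_sensed_lt_le (ω : Outcome U C) (n M : ℕ) (j : Fin U) :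
    ∑ k ∈ Finset.range n,
      ind ((states hUC σ π ω k j).sensed (sensedChannels hUC σ π ω k j) < M) ≤ C * M := by
  -- Each counted slot raises the number of sensings of `i`, capped at `M`, by one.
  have h1 (i : Fin C) : ∑ k ∈ Finset.range n, ind (sensedChannels hUC σ π ω k j = i ∧
      (states hUC σ π ω k j).sensed i < M)
      ≤ (min ((states hUC σ π ω n j).sensed i) M : ℕ) := by
    induction n with
    | zero => simp
    | succ n ih =>
      rw [Finset.sum_range_succ, sensed_succ]
      by_cases h : sensedChannels hUC σ π ω n j = i ∧ (states hUC σ π ω n j).sensed i < M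
      · rw [ind_of_true h, if_pos h.1]
        rw [min_eq_left h.2.le] at ih
        rw [min_eq_left (by omega)]
        push_cast
        linarith
      · rw [ind_of_false h, add_zero]
        refine ih.trans ?_
        exact_mod_cast min_le_min_right _ (Nat.le_add_right _ _)
  calc ∑ k ∈ Finset.range n,
        ind ((states hUC σ π ω k j).sensed (sensedChannels hUC σ π ω k j) < M)
      ≤ ∑ k ∈ Finset.range n, ∑ i, ind (sensedChannels hUC σ π ω k j = i ∧
          (states hUC σ π ω k j).sensed i < M) := by
        refine Finset.sum_le_sum fun k _ => ?_
        refine ind_le (Finset.sum_nonneg fun _ _ => ind_nonneg _) fun h => ?_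
        refine le_trans (ind_of_true ⟨rfl, h⟩).ge (Finset.single_le_sum
          (f := fun i => ind (sensedChannels hUC σ π ω k j = i ∧
            (states hUC σ π ω k j).sensed i < M)) (fun _ _ => ind_nonneg _)
          (Finset.mem_univ (sensedChannels hUC σ π ω k j)))
    _ = ∑ i, ∑ k ∈ Finset.range n, ind (sensedChannels hUC σ π ω k j = i ∧
          (states hUC σ π ω k j).sensed i < M) := Finset.sum_comm
    _ ≤ ∑ _i : Fin C, (M : ℝ) := by
        refine Finset.sum_le_sum fun i _ => (h1 i).trans ?_
        exact_mod_cast min_le_right _ _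
    _ = C * M := by simp

end Counting

/-! ### Hoeffding bound at a random number of observations. -/

section Concentration

variable {U C : ℕ} [NeZero U] (hUC : U ≤ C) (μ : Fin C → unitInterval)
  (σ : Fin U → (Fin C → ℝ) → Equiv.Perm (Fin C)) (π : Fin U → Equiv.Perm (Fin C))

lemma dependsOn_comp_states {α : Type*} (k : ℕ) (f : (Fin U → UserState U C) → α) :
    DependsOn (fun ω => f (states hUC σ π ω k)) (Set.Iio k) := fun ω ω' h => by
  have := dependsOn_states hUC σ π k h
  simp only at this
  simp only [this]

/-- The exponential supermartingale of the sensing results of one user on one channel. -/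
noncomputable def expDev (l : ℝ) (j : Fin U) (i : Fin C) (s : Fin U → UserState U C) : ℝ :=
  Real.exp (l * ((s j).free i - μ i * (s j).sensed i) - l ^ 2 / 8 * (s j).sensed i)

lemma integral_expDev_le (l : ℝ) (j : Fin U) (i : Fin C) (k : ℕ) :
    ∫ ω, expDev μ l j i (states hUC σ π ω k) ∂law U μ ≤ 1 := by
  induction k with
  | zero =>
    have : IsProbabilityMeasure (law U μ) := by unfold law; infer_instance
    simp [expDev, states]
  | succ k ih =>
    let A : Outcome U C → (Fin U → Fin U) → ℝ := fun ω d =>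
      expDev μ l j i (states hUC σ π ω k) * ind (channels hUC σ π k (states hUC σ π ω k) d j = i)
    let h : (Fin C → Bool) → ℝ := fun w =>
      Real.exp (l * ((if w i = true then 1 else 0) - μ i) - l ^ 2 / 8)
    have hA : ∀ d, DependsOn (fun ω => A ω d) (Set.Iio k) := fun d =>
      dependsOn_comp_states hUC σ π k fun s =>
        expDev μ l j i s * ind (channels hUC σ π k s d j = i)
    -- `A` is the part of `expDev` on which channel `i` is sensed. Only this part is multiplied by a
    -- new factor, which is independent of it and has mean at most `1`.
    have hstep (ω : Outcome U C) : expDev μ l j i (states hUC σ π ω (k + 1))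
        = expDev μ l j i (states hUC σ π ω k) - A ω (ω k).2 + A ω (ω k).2 * h (ω k).1 := by
      have hs := sensed_succ (hUC := hUC) (σ := σ) (π := π) ω k j i
      have hf := free_succ (hUC := hUC) (σ := σ) (π := π) ω k j i
      simp only [A, h, ← sensedChannels_eq]
      by_cases hc : sensedChannels hUC σ π ω k j = i
      · rw [ind_of_true hc, mul_one, sub_self, zero_add]
        simp only [expDev, hs, hf, hc, true_and, if_true]
        rw [← Real.exp_add]
        congr 1
        push_cast
        ring
      · rw [ind_of_false hc]
        simp [expDev, hs, hf, hc]
    have hint : Integrable (fun ω => expDev μ l j i (states hUC σ π ω k)) (law U μ) :=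
      integrable_of_dependsOn μ (dependsOn_comp_states hUC σ π k _)
    have hA1 : ∀ h : (Fin C → Bool) → ℝ,
        Integrable (fun ω => A ω (ω k).2 * h (ω k).1) (law U μ) := fun h =>
      integrable_of_dependsOn μ (dependsOn_slot (F := fun ω x => A ω x.2 * h x.1) fun x ω ω' hω => by
        simp only [show A ω x.2 = A ω' x.2 from hA x.2 hω])
    have hA0 : Integrable (fun ω => A ω (ω k).2) (law U μ) := by
      simpa using hA1 fun _ => 1
    simp_rw [hstep]
    rw [integral_add (by exact hint.sub hA0) (hA1 h), integral_sub hint hA0,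
      integral_mul_free μ hA h]
    have hw : ∑ w, freeWeight μ w * h w ≤ 1 := by
      have := sum_freeWeight_mul_apply μ i fun b =>
        Real.exp (l * ((if b = true then 1 else 0) - μ i) - l ^ 2 / 8)
      simp only [h]
      rw [this]
      simpa using bernoulli_mgf_le (μ i) l
    have hA2 : 0 ≤ ∫ ω, A ω (ω k).2 ∂law U μ :=
      integral_nonneg fun ω => mul_nonneg (Real.exp_pos _).le (ind_nonneg _)
    nlinarith

/-- The sample means are close to the true means with high probability. -/
lemma integral_not_confident_le {k : ℕ} (hk : C ≤ k) (hk1 : 1 ≤ k) :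
    ∫ ω, ind (¬ Confident μ k (states hUC σ π ω k)) ∂law U μ ≤ 2 * U * C / k := by
  have hk0 : (0 : ℝ) < k := by exact_mod_cast hk1
  have hk1' : (1 : ℝ) ≤ k := by exact_mod_cast hk1
  have hlog : 0 ≤ Real.log k := Real.log_nonneg hk1'
  let b : ℕ → ℝ := fun t => Real.sqrt (2 * Real.log k / t)
  -- After `t` sensings with a deviation beyond `b t`, the choice `l = ±4 * b t` gives an exponent
  -- of at least `4 * b t ^ 2 * t - 2 * b t ^ 2 * t = 4 * log k`. Since the number of sensings is
  -- random, all `t` are summed over.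
  let f : Fin U → Fin C → ℕ → (Fin U → UserState U C) → ℝ := fun j i t s =>
    ((k : ℝ) ^ 4)⁻¹ * (expDev μ (4 * b t) j i s + expDev μ (-(4 * b t)) j i s)
  have hf0 : ∀ j i t s, 0 ≤ f j i t s := fun j i t s => by
    simp only [f, expDev]; positivity
  have hint : ∀ g : (Fin U → UserState U C) → ℝ,
      Integrable (fun ω => g (states hUC σ π ω k)) (law U μ) := fun g =>
    integrable_of_dependsOn μ (dependsOn_comp_states hUC σ π k g)
  have hpt : ∀ ω, ind (¬ Confident μ k (states hUC σ π ω k))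
      ≤ ∑ j, ∑ i, ∑ t ∈ Finset.Icc 1 k, f j i t (states hUC σ π ω k) := by
    intro ω
    refine ind_le (Finset.sum_nonneg fun j _ => Finset.sum_nonneg fun i _ =>
      Finset.sum_nonneg fun t _ => hf0 j i t _) fun hc => ?_
    simp only [Confident, not_forall, not_le] at hc
    obtain ⟨j, i, hji⟩ := hc
    set s := states hUC σ π ω k with hs
    set t := (s j).sensed i with ht
    have ht1 : 1 ≤ t := one_le_sensed ω hk j i
    have htk : t ≤ k := sensed_le ω k j i
    have ht0 : (0 : ℝ) < t := by exact_mod_cast ht1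
    have hb2 : b t ^ 2 * t = 2 * Real.log k := by
      simp only [b]
      rw [Real.sq_sqrt (by positivity)]
      field_simp
    have hb0 : 0 ≤ b t := Real.sqrt_nonneg _
    have hkey : 1 ≤ f j i t s := by
      have hk4 : (k : ℝ) ^ 4 = Real.exp (4 * Real.log k) := by
        rw [mul_comm, Real.exp_mul, Real.exp_log hk0]; norm_cast
      have e : ((s j).free i : ℝ) - μ i * t = ((s j).free i / t - μ i) * t := by
        field_simp
      have : (k : ℝ) ^ 4 ≤ expDev μ (4 * b t) j i s + expDev μ (-(4 * b t)) j i s := by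
        rw [hk4]
        simp only [expDev, ← ht, e]
        rcases lt_abs.1 hji with h | h
        · refine le_add_of_le_of_nonneg (Real.exp_le_exp.2 ?_) (Real.exp_pos _).le
          have h' : b t < (s j).free i / t - μ i := h
          nlinarith [mul_le_mul_of_nonneg_left h'.le (mul_nonneg hb0 ht0.le)]
        · refine le_add_of_nonneg_of_le (Real.exp_pos _).le (Real.exp_le_exp.2 ?_)
          have h' : b t < -((s j).free i / t - μ i) := h
          nlinarith [mul_le_mul_of_nonneg_left h'.le (mul_nonneg hb0 ht0.le)]
      simp only [f]
      rw [inv_mul_eq_div, one_le_div (by positivity)]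
      exact this
    refine hkey.trans ?_
    refine (Finset.single_le_sum (f := fun t => f j i t s) (fun t _ => hf0 j i t s)
      (Finset.mem_Icc.2 ⟨ht1, htk⟩)).trans ?_
    refine (Finset.single_le_sum (f := fun i => ∑ t ∈ Finset.Icc 1 k, f j i t s)
      (fun i _ => Finset.sum_nonneg fun t _ => hf0 j i t s) (Finset.mem_univ i)).trans ?_
    exact Finset.single_le_sum (f := fun j => ∑ i, ∑ t ∈ Finset.Icc 1 k, f j i t s)
      (fun j _ => Finset.sum_nonneg fun i _ => Finset.sum_nonneg fun t _ => hf0 j i t s)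
      (Finset.mem_univ j)
  have hfi : ∀ j i t, ∫ ω, f j i t (states hUC σ π ω k) ∂law U μ ≤ ((k : ℝ) ^ 4)⁻¹ * 2 := by
    intro j i t
    simp only [f]
    rw [integral_const_mul, integral_add (hint _) (hint _)]
    have h1 := integral_expDev_le hUC μ σ π (4 * b t) j i k
    have h2 := integral_expDev_le hUC μ σ π (-(4 * b t)) j i k
    exact mul_le_mul_of_nonneg_left (by linarith) (by positivity)
  calc ∫ ω, ind (¬ Confident μ k (states hUC σ π ω k)) ∂law U μ
      ≤ ∫ ω, ∑ j, ∑ i, ∑ t ∈ Finset.Icc 1 k, f j i t (states hUC σ π ω k) ∂law U μ :=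
        integral_mono (hint fun s => ind (¬ Confident μ k s))
          (hint fun s => ∑ j, ∑ i, ∑ t ∈ Finset.Icc 1 k, f j i t s) hpt
    _ = ∑ j, ∑ i, ∑ t ∈ Finset.Icc 1 k, ∫ ω, f j i t (states hUC σ π ω k) ∂law U μ := by
        rw [integral_finsetSum _ fun j _ => hint fun s => ∑ i, ∑ t ∈ Finset.Icc 1 k, f j i t s]
        refine Finset.sum_congr rfl fun j _ => ?_
        rw [integral_finsetSum _ fun i _ => hint fun s => ∑ t ∈ Finset.Icc 1 k, f j i t s]
        refine Finset.sum_congr rfl fun i _ => ?_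
        rw [integral_finsetSum _ fun t _ => hint fun s => f j i t s]
    _ ≤ ∑ _j : Fin U, ∑ _i : Fin C, ∑ t ∈ Finset.Icc 1 k, ((k : ℝ) ^ 4)⁻¹ * 2 := by
        gcongr with j _ i _ t _
        exact hfi j i t
    _ = 2 * U * C / k * ((k : ℝ) ^ 2)⁻¹ := by
        simp only [Finset.sum_const, Finset.card_univ, Fintype.card_fin, Nat.card_Icc, nsmul_eq_mul]
        push_cast
        field_simp
    _ ≤ 2 * U * C / k := mul_le_of_le_one_right (by positivity)
        (inv_le_one_of_one_le₀ (one_le_pow₀ hk1'))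

end Concentration

lemma ite_eq_ind (p : Prop) [Decidable p] : (if p then (1 : ℝ) else 0) = ind p := by
  by_cases h : p <;> simp [ind, h]

/-! ### Expected loss of a fixed configuration. -/

section Loss

variable {U C : ℕ} (hUC : U ≤ C) (μ : Fin C → unitInterval)

/-- The expected number of successes that the users lose in a slot if they sense the
channels `a` rather than the `U` best channels. -/
noncomputable def loss (a : Fin U → Fin C) : ℝ :=
  ∑ T : Fin U, (μ (bestChannel μ (Fin.castLE hUC T)) : ℝ) - ∑ j, ind (Alone a j) * (μ (a j) : ℝ)

lemma loss_le (a : Fin U → Fin C) : loss hUC μ a ≤ U := by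
  have h1 : ∑ T : Fin U, (μ (bestChannel μ (Fin.castLE hUC T)) : ℝ) ≤ ∑ _T : Fin U, (1 : ℝ) :=
    Finset.sum_le_sum fun T _ => (μ _).2.2
  have h2 : 0 ≤ ∑ j, ind (Alone a j) * (μ (a j) : ℝ) :=
    Finset.sum_nonneg fun j _ => mul_nonneg (ind_nonneg _) (μ _).2.1
  simp at h1
  unfold loss
  linarith

open Classical in
/-- The channels on which exactly one user is. -/
noncomputable def aloneChannels (a : Fin U → Fin C) : Finset (Fin C) :=
  (Finset.univ.filter (Alone a)).image a

lemma card_aloneChannels_le (a : Fin U → Fin C) : (aloneChannels a).card ≤ U := by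
  classical
  refine Finset.card_image_le.trans ((Finset.card_filter_le _ _).trans ?_)
  simp

lemma sum_topChannels : ∑ T : Fin U, (μ (bestChannel μ (Fin.castLE hUC T)) : ℝ)
    = ∑ i ∈ topChannels hUC μ, (μ i : ℝ) := by
  rw [topChannels, Finset.sum_image fun _ _ _ _ h => injective_bestChannel_castLE hUC μ h]

/-- Users that are alone sit on distinct channels, so configurations can be compared through sets of
channels. -/
lemma loss_eq (a : Fin U → Fin C) :
    loss hUC μ a = ∑ i ∈ topChannels hUC μ, (μ i : ℝ) - ∑ i ∈ aloneChannels a, (μ i : ℝ) := by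
  classical
  rw [loss, sum_topChannels, aloneChannels, Finset.sum_image, Finset.sum_filter]
  · congr 1
    exact Finset.sum_congr rfl fun j _ => by by_cases h : Alone a j <;> simp [ind, h]
  · intro j hj j' hj' e
    exact (Finset.mem_filter.1 hj').2 j e

variable {hUC μ}

lemma aloneChannels_eq_iff (a : Fin U → Fin C) :
    aloneChannels a = topChannels hUC μ ↔ Orthogonal hUC μ a := by
  classical
  constructor
  · intro h
    have h1 : U ≤ (Finset.univ.filter (Alone a)).card :=
      (card_topChannels hUC μ).ge.trans (h ▸ Finset.card_image_le)
    have h2 : Finset.univ.filter (Alone a) = Finset.univ :=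
      Finset.eq_univ_of_card _ (le_antisymm (Finset.card_le_univ _) (by simpa using h1))
    have h3 : ∀ j, Alone a j := fun j => by
      have : j ∈ Finset.univ.filter (Alone a) := by rw [h2]; exact Finset.mem_univ j
      exact (Finset.mem_filter.1 this).2
    refine ⟨fun j => ?_, fun j j' e => h3 j' j e⟩
    rw [← h]
    exact Finset.mem_image_of_mem a (by simpa using h3 j)
  · intro h
    refine Finset.eq_of_subset_of_card_le ?_ ?_
    · intro i hi
      obtain ⟨j, -, rfl⟩ := Finset.mem_image.1 hi
      exact h.1 j
    · have : Finset.univ.filter (Alone a) = Finset.univ :=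
        Finset.filter_true_of_mem fun j _ j' hj' => h.2 hj'
      rw [card_topChannels, aloneChannels, this, Finset.card_image_of_injective _ h.2]
      simp

lemma loss_of_orthogonal {a : Fin U → Fin C} (h : Orthogonal hUC μ a) :
    loss hUC μ a = 0 := by
  rw [loss_eq, (aloneChannels_eq_iff a).2 h, sub_self]

/-- The `U` best channels are the only set of at most `U` channels with the highest total mean. -/
lemma sum_lt_sum_topChannels [NeZero U] (hpos : ∀ i, 0 < (μ i : ℝ))
    (hinj : Function.Injective μ) {A : Finset (Fin C)} (hA : A.card ≤ U)
    (hne : A ≠ topChannels hUC μ) :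
    ∑ i ∈ A, (μ i : ℝ) < ∑ i ∈ topChannels hUC μ, (μ i : ℝ) := by
  classical
  have hU : 0 < U := Nat.pos_of_ne_zero (NeZero.ne U)
  set B := topChannels hUC μ with hB
  let r : Fin C := Fin.castLE hUC ⟨U - 1, by omega⟩
  -- `θ` is the `U`-th highest mean. After subtracting it, channels of the best set contribute
  -- nonnegatively and all others negatively; `θ > 0` penalizes sets with fewer than `U` channels.
  set θ := (μ (bestChannel μ r) : ℝ) with hθ
  have htop : ∀ i ∈ B, 0 ≤ (μ i : ℝ) - θ := by
    intro i hi
    obtain ⟨T, -, rfl⟩ := Finset.mem_image.1 hi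
    have : Fin.castLE hUC T ≤ r := by
      rw [Fin.le_def]
      simp only [r, Fin.val_castLE]
      omega
    have := antitone_bestChannel μ this
    simp only [Function.comp_apply] at this
    linarith
  have hnot : ∀ i ∉ B, (μ i : ℝ) - θ < 0 := by
    intro i hi
    have hT : ¬ ((bestChannel μ).symm i : ℕ) < U := fun hT =>
      hi (Finset.mem_image.2 ⟨⟨_, hT⟩, Finset.mem_univ _, by simp⟩)
    have hlt : r < (bestChannel μ).symm i := by
      rw [Fin.lt_def]
      simp only [r, Fin.val_castLE]
      omega
    have h1 := antitone_bestChannel μ hlt.le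
    simp only [Function.comp_apply, Equiv.apply_symm_apply] at h1
    have h2 : (μ i : ℝ) ≠ θ := fun e => by
      have := congrArg (bestChannel μ).symm (hinj (Subtype.ext e))
      rw [Equiv.symm_apply_apply] at this
      exact hlt.ne this.symm
    have := lt_of_le_of_ne h1 h2
    linarith
  have hsplit : ∀ S : Finset (Fin C), ∑ i ∈ S, (μ i : ℝ) = ∑ i ∈ S, ((μ i : ℝ) - θ) + S.card * θ := by
    intro S
    simp
  have h1 : ∑ i ∈ A ∩ B, ((μ i : ℝ) - θ) ≤ ∑ i ∈ B, ((μ i : ℝ) - θ) :=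
    Finset.sum_le_sum_of_subset_of_nonneg Finset.inter_subset_right fun i hi _ => htop i hi
  have h2 : ∑ i ∈ A, ((μ i : ℝ) - θ)
      = ∑ i ∈ A ∩ B, ((μ i : ℝ) - θ) + ∑ i ∈ A \ B, ((μ i : ℝ) - θ) :=
    (Finset.sum_inter_add_sum_sdiff A B _).symm
  have h3 : ∑ i ∈ A \ B, ((μ i : ℝ) - θ) ≤ 0 :=
    Finset.sum_nonpos fun i hi => (hnot i (Finset.mem_sdiff.1 hi).2).le
  have hcB : B.card = U := card_topChannels hUC μ
  have hθ0 : 0 < θ := hpos _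
  have hA' : (A.card : ℝ) ≤ U := by exact_mod_cast hA
  rw [hsplit A, hsplit B, hcB]
  rcases hA.lt_or_eq with hlt | heq
  · have : (A.card : ℝ) < U := by exact_mod_cast hlt
    have := mul_lt_mul_of_pos_right this hθ0
    linarith
  · have : (A \ B).Nonempty := by
      rw [Finset.sdiff_nonempty]
      exact fun hsub => hne (Finset.eq_of_subset_of_card_le hsub (by omega))
    have h4 : ∑ i ∈ A \ B, ((μ i : ℝ) - θ) < 0 :=
      Finset.sum_neg (fun i hi => hnot i (Finset.mem_sdiff.1 hi).2) this
    rw [heq]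
    linarith

/-- There are finitely many configurations, so strict suboptimality gives a uniform gap. -/
lemma exists_le_loss [NeZero U] (hpos : ∀ i, 0 < (μ i : ℝ)) (hinj : Function.Injective μ) :
    ∃ δ, 0 < δ ∧ ∀ a : Fin U → Fin C, ¬ Orthogonal hUC μ a → δ ≤ loss hUC μ a := by
  have hlt : ∀ a : Fin U → Fin C, ¬ Orthogonal hUC μ a → 0 < loss hUC μ a := fun a ha => by
    rw [loss_eq, sub_pos]
    exact sum_lt_sum_topChannels hpos hinj (card_aloneChannels_le a)
      fun e => ha ((aloneChannels_eq_iff a).1 e)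
  rcases isEmpty_or_nonempty {a : Fin U → Fin C // ¬ Orthogonal hUC μ a} with he | he
  · exact ⟨1, one_pos, fun a ha => (he.false ⟨a, ha⟩).elim⟩
  · obtain ⟨a₀, h₀⟩ := Finite.exists_min
      fun a : {a : Fin U → Fin C // ¬ Orthogonal hUC μ a} => loss hUC μ a
    exact ⟨loss hUC μ a₀, hlt _ a₀.2, fun a ha => h₀ ⟨a, ha⟩⟩

lemma loss_nonneg {δ : ℝ} (hδ : 0 < δ)
    (h : ∀ a : Fin U → Fin C, ¬ Orthogonal hUC μ a → δ ≤ loss hUC μ a) (a : Fin U → Fin C) :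
    0 ≤ loss hUC μ a := by
  by_cases ho : Orthogonal hUC μ a
  · exact (loss_of_orthogonal ho).ge
  · exact hδ.le.trans (h a ho)

end Loss

/-! ### Regret as a sum of expected losses. -/

section Regret

variable {U C : ℕ} [NeZero U] (hUC : U ≤ C) (μ : Fin C → unitInterval)
  (σ : Fin U → (Fin C → ℝ) → Equiv.Perm (Fin C)) (π : Fin U → Equiv.Perm (Fin C))

instance isProbabilityMeasure_law : IsProbabilityMeasure (law U μ) := by
  unfold law; infer_instance

lemma integrable_slot (k : ℕ) (f : (Fin U → UserState U C) → SlotInput U C → ℝ) :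
    Integrable (fun ω => f (states hUC σ π ω k) (ω k)) (law U μ) :=
  integrable_of_dependsOn μ (dependsOn_slot (F := fun ω x => f (states hUC σ π ω k) x)
    fun x => dependsOn_comp_states hUC σ π k fun s => f s x)

/-- The channels are chosen from the past and the fresh ranks, independently of the availabilities.
Splitting by the chosen channel lets each availability be replaced by its mean. -/
lemma integral_success (k : ℕ) (j : Fin U) :
    ∫ ω, ind ((ω k).1 (sensedChannels hUC σ π ω k j) = true ∧
        Alone (sensedChannels hUC σ π ω k) j) ∂law U μ
      = ∫ ω, ind (Alone (sensedChannels hUC σ π ω k) j)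
          * (μ (sensedChannels hUC σ π ω k j) : ℝ) ∂law U μ := by
  classical
  let A : Fin C → (Fin U → UserState U C) → (Fin U → Fin U) → ℝ := fun i s d =>
    ind (Alone (channels hUC σ π k s d) j ∧ channels hUC σ π k s d j = i)
  have hsum (s : Fin U → UserState U C) (d : Fin U → Fin U) (φ : Fin C → ℝ) :
      ind (Alone (channels hUC σ π k s d) j) * φ (channels hUC σ π k s d j)
        = ∑ i, A i s d * φ i := by
    simp only [A]
    rw [Finset.sum_eq_single (channels hUC σ π k s d j)]
    · simp
    · intro i _ hi
      rw [ind_of_false fun h => hi h.2.symm, zero_mul]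
    · simp
  have hl (ω : Outcome U C) : ind ((ω k).1 (sensedChannels hUC σ π ω k j) = true ∧
        Alone (sensedChannels hUC σ π ω k) j)
      = ∑ i, A i (states hUC σ π ω k) (ω k).2 * ind ((ω k).1 i = true) := by
    rw [← hsum _ _ fun i => ind ((ω k).1 i = true)]
    simp only [sensedChannels_eq]
    by_cases h1 : Alone (channels hUC σ π k (states hUC σ π ω k) (ω k).2) j <;>
      simp [h1, ind]
  simp_rw [hl, sensedChannels_eq, hsum _ _ fun i => (μ i : ℝ)]
  rw [integral_finsetSum _ fun i _ => integrable_slot hUC μ σ π k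
      fun s x => A i s x.2 * ind (x.1 i = true),
    integral_finsetSum _ fun i _ => integrable_slot hUC μ σ π k fun s x => A i s x.2 * μ i]
  refine Finset.sum_congr rfl fun i _ => ?_
  rw [integral_mul_free μ (F := fun ω d => A i (states hUC σ π ω k) d)
    (fun d => dependsOn_comp_states hUC σ π k fun s => A i s d) fun w => ind (w i = true),
    sum_freeWeight_mul_apply μ i fun b => ind (b = true), integral_mul_const]
  simp [ind, mul_comm]

lemma regret_eq (n : ℕ) : regret hUC μ σ π n
    = ∑ k ∈ Finset.range n, ∫ ω, loss hUC μ (sensedChannels hUC σ π ω k) ∂law U μ := by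
  classical
  have h (k : ℕ) : ∫ ω, loss hUC μ (sensedChannels hUC σ π ω k) ∂law U μ
      = ∑ T : Fin U, (μ (bestChannel μ (Fin.castLE hUC T)) : ℝ)
        - ∑ j, ∫ ω, ind ((ω k).1 (sensedChannels hUC σ π ω k j) = true ∧
          Alone (sensedChannels hUC σ π ω k) j) ∂law U μ := by
    simp only [loss, integral_success]
    simp only [sensedChannels_eq]
    rw [integral_sub (integrable_const _) (integrable_slot hUC μ σ π k fun s x =>
        ∑ j, ind (Alone (channels hUC σ π k s x.2) j) * (μ (channels hUC σ π k s x.2 j) : ℝ)),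
      integral_finsetSum _ fun j _ => integrable_slot hUC μ σ π k fun s x =>
        ind (Alone (channels hUC σ π k s x.2) j) * (μ (channels hUC σ π k s x.2 j) : ℝ)]
    simp
  have hint (k : ℕ) (j : Fin U) : Integrable (fun ω : Outcome U C =>
      ind ((ω k).1 (sensedChannels hUC σ π ω k j) = true ∧
          Alone (sensedChannels hUC σ π ω k) j)) (law U μ) :=
    integrable_slot hUC μ σ π k fun s x => ind (x.1 (channels hUC σ π k s x.2 j) = true ∧
          Alone (channels hUC σ π k s x.2) j)
  have hs : ∫ ω, successes hUC σ π n ω ∂law U μ = ∑ k ∈ Finset.range n, ∑ j,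
      ∫ ω, ind ((ω k).1 (sensedChannels hUC σ π ω k j) = true ∧
          Alone (sensedChannels hUC σ π ω k) j) ∂law U μ := by
    simp only [successes, ite_eq_ind]
    rw [integral_finsetSum _ fun k _ => integrable_finsetSum _ fun j _ => hint k j]
    refine Finset.sum_congr rfl fun k _ => ?_
    rw [integral_finsetSum _ fun j _ => hint k j]
  simp_rw [h, Finset.sum_sub_distrib]
  rw [regret, hs]
  simp

end Regret

/-! ### Logarithmic upper bound. -/

section UpperBound

variable {U C : ℕ} [NeZero U] {hUC : U ≤ C} {μ : Fin C → unitInterval}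
  {σ : Fin U → (Fin C → ℝ) → Equiv.Perm (Fin C)} {π : Fin U → Equiv.Perm (Fin C)}

lemma sum_freeWeight_mul_ind_forall :
    ∑ w, freeWeight μ w * ind (∀ i, w i = true) = ∏ i, (μ i : ℝ) := by
  rw [Finset.sum_eq_single fun _ => true]
  · simp [ind, freeWeight, bernWeight]
  · intro w _ hw
    rw [ind_of_false fun h => hw (funext h), mul_zero]
  · simp

/-- In regular slots the users leave configurations that are not orthogonal
with a probability that is bounded below. -/
lemma integral_not_orthogonal_succ_le {M k : ℕ} {ε : ℝ} (hσ : ∀ j, IsRankingRule (σ j))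
    (hε : 0 < ε) (hμ : Separated μ ε) (hC : C ≤ k) (hk : 2 ≤ ε ^ 2 * k)
    (hM : 8 * Real.log k ≤ ε ^ 2 * M) (hM' : 8 * Real.log (k + 1 : ℕ) ≤ ε ^ 2 * M) :
    ∫ ω, ind (Regular hUC μ σ π M (k + 1) (states hUC σ π ω (k + 1)) (ω (k + 1)).2 ∧
        ¬ Orthogonal hUC μ (sensedChannels hUC σ π ω (k + 1))) ∂law U μ
      ≤ ∫ ω, ind (¬ Regular hUC μ σ π M k (states hUC σ π ω k) (ω k).2) ∂law U μ
        + (1 - (∏ i, (μ i : ℝ)) * ((U : ℝ)⁻¹) ^ U)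
          * ∫ ω, ind (Regular hUC μ σ π M k (states hUC σ π ω k) (ω k).2 ∧
              ¬ Orthogonal hUC μ (sensedChannels hUC σ π ω k)) ∂law U μ := by
  classical
  let P : (Fin U → UserState U C) → (Fin U → Fin U) → Prop := fun s d =>
    Regular hUC μ σ π M (k + 1) s d → Orthogonal hUC μ (channels hUC σ π (k + 1) s d)
  let B : (Fin U → UserState U C) → (Fin U → Fin U) → ℝ := fun s d =>
    ind (Regular hUC μ σ π M k s d ∧ ¬ Orthogonal hUC μ (channels hUC σ π k s d))
  let Z : Outcome U C → ℝ := fun ω => B (states hUC σ π ω k) (ω k).2 * ind (∀ i, (ω k).1 i = true)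
  -- A favourable vector of fresh ranks, chosen from the state before slot `k + 1`. The ranks used
  -- after a collision in slot `k` belong to slot `k + 1`, so they match `D` with probability `U ^
  -- (-U)` given the past.
  let D : Outcome U C → Fin U → Fin U := fun ω =>
    Classical.epsilon (P (states hUC σ π ω (k + 1)))
  have hZ : DependsOn Z (Set.Iio (k + 1)) :=
    dependsOn_slot (F := fun ω x => B (states hUC σ π ω k) x.2 * ind (∀ i, x.1 i = true))
      fun x => dependsOn_comp_states hUC σ π k fun s => B s x.2 * ind (∀ i, x.1 i = true)
  have hD : DependsOn D (Set.Iio (k + 1)) :=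
    dependsOn_comp_states hUC σ π (k + 1) fun s => Classical.epsilon (P s)
  have hpt (ω : Outcome U C) :
      ind (Regular hUC μ σ π M (k + 1) (states hUC σ π ω (k + 1)) (ω (k + 1)).2 ∧
        ¬ Orthogonal hUC μ (sensedChannels hUC σ π ω (k + 1)))
      ≤ ind (¬ Regular hUC μ σ π M k (states hUC σ π ω k) (ω k).2)
        + B (states hUC σ π ω k) (ω k).2 - Z ω * (if (ω (k + 1)).2 = D ω then 1 else 0) := by
    have hnn : 0 ≤ B (states hUC σ π ω k) (ω k).2
        - Z ω * (if (ω (k + 1)).2 = D ω then 1 else 0) := by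
      have h1 : Z ω ≤ B (states hUC σ π ω k) (ω k).2 :=
        mul_le_of_le_one_right (ind_nonneg _) (ind_le_one _)
      have h2 : 0 ≤ Z ω := mul_nonneg (ind_nonneg _) (ind_nonneg _)
      split_ifs <;> simp <;> linarith
    by_cases hR : Regular hUC μ σ π M k (states hUC σ π ω k) (ω k).2
    swap
    · rw [ind_of_true hR]
      linarith [ind_le_one (Regular hUC μ σ π M (k + 1) (states hUC σ π ω (k + 1)) (ω (k + 1)).2 ∧
        ¬ Orthogonal hUC μ (sensedChannels hUC σ π ω (k + 1)))]
    rw [ind_of_false (not_not.2 hR), zero_add]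
    refine ind_le hnn fun h => ?_
    rw [states_succ] at h
    by_cases hO : Orthogonal hUC μ (channels hUC σ π k (states hUC σ π ω k) (ω k).2)
    · exact absurd (hO.nextStates hσ hε hμ hC hk hM hM' hR h.1) h.2
    have hB : B (states hUC σ π ω k) (ω k).2 = 1 := ind_of_true ⟨hR, hO⟩
    by_cases hfree : ∀ i, (ω k).1 i = true
    · have hd : (ω (k + 1)).2 ≠ D ω := by
        intro e
        have := Classical.epsilon_spec (p := P (states hUC σ π ω (k + 1)))
          (exists_fresh_orthogonal hσ hε hμ hC hk hM hM' hR hfree)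
        change P (states hUC σ π ω (k + 1)) (D ω) at this
        rw [← e] at this
        exact h.2 (this h.1)
      simp [hB, hd]
    · simp [Z, hB, ind_of_false hfree]
  have hiB : Integrable (fun ω => B (states hUC σ π ω k) (ω k).2) (law U μ) :=
    integrable_slot hUC μ σ π k fun s x => B s x.2
  have hiR : Integrable (fun ω => ind (¬ Regular hUC μ σ π M k (states hUC σ π ω k) (ω k).2))
      (law U μ) :=
    integrable_slot hUC μ σ π k fun s x => ind (¬ Regular hUC μ σ π M k s x.2)
  have hiZ : Integrable (fun ω => Z ω * (if (ω (k + 1)).2 = D ω then 1 else 0)) (law U μ) :=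
    integrable_of_dependsOn μ (dependsOn_slot
      (F := fun ω x => Z ω * (if x.2 = D ω then 1 else 0)) fun x ω ω' h => by
        simp only [hZ h, hD h])
  refine (integral_mono (integrable_slot hUC μ σ π (k + 1) fun s x =>
    ind (Regular hUC μ σ π M (k + 1) s x.2 ∧ ¬ Orthogonal hUC μ (channels hUC σ π (k + 1) s x.2)))
    ((hiR.add hiB).sub hiZ) hpt).trans (le_of_eq ?_)
  simp only [Pi.sub_apply, Pi.add_apply]
  rw [integral_sub (by exact hiR.add hiB) hiZ, integral_add hiR hiB, integral_mul_fresh μ hZ hD,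
    integral_mul_free μ (F := fun ω d => B (states hUC σ π ω k) d)
      (fun d => dependsOn_comp_states hUC σ π k fun s => B s d) fun w => ind (∀ i, w i = true),
    sum_freeWeight_mul_ind_forall]
  simp only [B, ← sensedChannels_eq]
  ring

lemma integral_ind_le_one (p : Outcome U C → Prop) : ∫ ω, ind (p ω) ∂law U μ ≤ 1 := by
  by_cases h : Integrable (fun ω => ind (p ω)) (law U μ)
  · calc ∫ ω, ind (p ω) ∂law U μ ≤ ∫ _ω, (1 : ℝ) ∂law U μ :=
        integral_mono h (integrable_const _) fun ω => ind_le_one _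
      _ = 1 := by simp
  · rw [integral_undef h]
    exact zero_le_one

/-- Sums the recursion `x (k + 1) ≤ y k + (1 - p) * x k`. The induction also carries the last term
`x n`, which is dropped at the end. -/
lemma sum_integral_not_orthogonal_le {M K N : ℕ} {ε : ℝ} (hσ : ∀ j, IsRankingRule (σ j))
    (hε : 0 < ε) (hμ : Separated μ ε) (hC : C ≤ K) (hK1 : 1 ≤ K)
    (hK : 2 ≤ ε ^ 2 * K) (hM : 8 * Real.log N ≤ ε ^ 2 * M) (hN : K ≤ N) :
    (∏ i, (μ i : ℝ)) * ((U : ℝ)⁻¹) ^ U * ∑ k ∈ Finset.Ico K N,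
        ∫ ω, ind (Regular hUC μ σ π M k (states hUC σ π ω k) (ω k).2 ∧
          ¬ Orthogonal hUC μ (sensedChannels hUC σ π ω k)) ∂law U μ
      ≤ 1 + ∑ k ∈ Finset.Ico K N,
          ∫ ω, ind (¬ Regular hUC μ σ π M k (states hUC σ π ω k) (ω k).2) ∂law U μ := by
  set p := (∏ i, (μ i : ℝ)) * ((U : ℝ)⁻¹) ^ U
  set x : ℕ → ℝ := fun k => ∫ ω, ind (Regular hUC μ σ π M k (states hUC σ π ω k) (ω k).2 ∧
          ¬ Orthogonal hUC μ (sensedChannels hUC σ π ω k)) ∂law U μ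
  set y : ℕ → ℝ := fun k =>
    ∫ ω, ind (¬ Regular hUC μ σ π M k (states hUC σ π ω k) (ω k).2) ∂law U μ
  have hx0 : ∀ k, 0 ≤ x k := fun k => integral_nonneg fun ω => ind_nonneg _
  have hlog : ∀ k : ℕ, 1 ≤ k → k ≤ N → 8 * Real.log k ≤ ε ^ 2 * M := by
    intro k hk1 hkN
    refine le_trans ?_ hM
    have : (0 : ℝ) < k := by exact_mod_cast hk1
    gcongr
  have claim : ∀ n, K ≤ n → n ≤ N →
      p * ∑ k ∈ Finset.Ico K n, x k + x n ≤ 1 + ∑ k ∈ Finset.Ico K n, y k := by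
    intro n hn
    induction n, hn using Nat.le_induction with
    | base =>
      intro _
      simpa using integral_ind_le_one _
    | succ n hn ih =>
      intro hnN
      have h1 := ih (by omega)
      have h2 : x (n + 1) ≤ y n + (1 - p) * x n :=
        integral_not_orthogonal_succ_le hσ hε hμ (hC.trans hn)
          (hK.trans (by gcongr)) (hlog n (hK1.trans hn) (by omega)) (hlog _ (by omega) hnN)
      rw [Finset.sum_Ico_succ_top hn, Finset.sum_Ico_succ_top hn]
      linarith
  linarith [claim N hN le_rfl, hx0 N]

lemma sum_integral_not_regular_le {M K N : ℕ} (hC : C ≤ K) (hK1 : 1 ≤ K) :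
    ∑ k ∈ Finset.Ico K N,
        ∫ ω, ind (¬ Regular hUC μ σ π M k (states hUC σ π ω k) (ω k).2) ∂law U μ
      ≤ 2 * U * C * (1 + Real.log N) + U * (C * M) := by
  let S : ℕ → Fin U → (Fin U → UserState U C) → SlotInput U C → ℝ := fun k j s x =>
    ind ((s j).sensed (channels hUC σ π k s x.2 j) < M)
  have hS (k : ℕ) (j : Fin U) : Integrable (fun ω => S k j (states hUC σ π ω k) (ω k)) (law U μ) :=
    integrable_slot hUC μ σ π k (S k j)
  have hpt (k : ℕ) (ω : Outcome U C) :
      ind (¬ Regular hUC μ σ π M k (states hUC σ π ω k) (ω k).2)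
        ≤ ind (¬ Confident μ k (states hUC σ π ω k)) + ∑ j, S k j (states hUC σ π ω k) (ω k) := by
    have hs0 : 0 ≤ ∑ j, S k j (states hUC σ π ω k) (ω k) :=
      Finset.sum_nonneg fun j _ => ind_nonneg _
    refine ind_le (add_nonneg (ind_nonneg _) hs0) fun h => ?_
    by_cases hc : Confident μ k (states hUC σ π ω k)
    · simp only [Regular, hc, true_and, not_forall, not_le] at h
      obtain ⟨j, hj⟩ := h
      have := Finset.single_le_sum (f := fun j => S k j (states hUC σ π ω k) (ω k))
        (fun j _ => ind_nonneg _) (Finset.mem_univ j)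
      have h1 : S k j (states hUC σ π ω k) (ω k) = 1 := ind_of_true hj
      linarith [ind_nonneg (¬ Confident μ k (states hUC σ π ω k))]
    · rw [ind_of_true hc]
      linarith
  have hk (k : ℕ) (hkK : K ≤ k) :
      ∫ ω, ind (¬ Regular hUC μ σ π M k (states hUC σ π ω k) (ω k).2) ∂law U μ
        ≤ 2 * U * C * (k : ℝ)⁻¹ + ∫ ω, ∑ j, S k j (states hUC σ π ω k) (ω k) ∂law U μ := by
    have h1 : Integrable (fun ω => ind (¬ Confident μ k (states hUC σ π ω k))) (law U μ) :=
      integrable_slot hUC μ σ π k fun s _ => ind (¬ Confident μ k s)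
    have h2 := integrable_finsetSum Finset.univ fun j _ => hS k j
    calc _ ≤ ∫ ω, (ind (¬ Confident μ k (states hUC σ π ω k))
            + ∑ j, S k j (states hUC σ π ω k) (ω k)) ∂law U μ :=
          integral_mono (integrable_slot hUC μ σ π k fun s x =>
            ind (¬ Regular hUC μ σ π M k s x.2)) (h1.add h2) (hpt k)
      _ = _ := integral_add h1 h2
      _ ≤ _ := by
        have := integral_not_confident_le hUC μ σ π (hC.trans hkK) (hK1.trans hkK)
        rw [div_eq_mul_inv] at this
        linarith
  have hharm : ∑ k ∈ Finset.Ico K N, ((k : ℝ))⁻¹ ≤ 1 + Real.log N := by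
    have h1 : ∑ k ∈ Finset.Icc 1 N, ((k : ℝ))⁻¹ ≤ 1 + Real.log N := by
      have := harmonic_le_one_add_log N
      rw [harmonic_eq_sum_Icc] at this
      push_cast at this
      exact this
    refine le_trans (Finset.sum_le_sum_of_subset_of_nonneg ?_ fun _ _ _ => by positivity) h1
    intro k hk
    rw [Finset.mem_Ico] at hk
    rw [Finset.mem_Icc]
    omega
  have hexp : ∑ k ∈ Finset.Ico K N, ∫ ω, ∑ j, S k j (states hUC σ π ω k) (ω k) ∂law U μ
      ≤ U * (C * M) := by
    rw [← integral_finsetSum _ fun k _ => integrable_finsetSum _ fun j _ => hS k j]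
    calc _ ≤ ∫ _ω : Outcome U C, (U * (C * M) : ℝ) ∂law U μ := by
          refine integral_mono (integrable_finsetSum _ fun k _ =>
            integrable_finsetSum _ fun j _ => hS k j) (integrable_const _) fun ω => ?_
          beta_reduce
          rw [Finset.sum_comm]
          calc _ ≤ ∑ _j : Fin U, (C * M : ℝ) := Finset.sum_le_sum fun j _ => by
                refine le_trans (Finset.sum_le_sum_of_subset_of_nonneg ?_
                  fun k _ _ => ind_nonneg _) (sum_ind_sensed_lt_le (hUC := hUC) (σ := σ) (π := π)
                    ω N M j)
                intro k hk
                exact Finset.mem_range.2 (Finset.mem_Ico.1 hk).2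
            _ = U * (C * M) := by simp
      _ = _ := by simp
  calc _ ≤ ∑ k ∈ Finset.Ico K N, (2 * U * C * (k : ℝ)⁻¹
          + ∫ ω, ∑ j, S k j (states hUC σ π ω k) (ω k) ∂law U μ) :=
        Finset.sum_le_sum fun k hk' => hk k (Finset.mem_Ico.1 hk').1
    _ ≤ _ := by
      rw [Finset.sum_add_distrib, ← Finset.mul_sum]
      exact add_le_add (mul_le_mul_of_nonneg_left hharm (by positivity)) hexp

lemma integral_loss_le (M k : ℕ) :
    ∫ ω, loss hUC μ (sensedChannels hUC σ π ω k) ∂law U μ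
      ≤ U * (∫ ω, ind (Regular hUC μ σ π M k (states hUC σ π ω k) (ω k).2 ∧
          ¬ Orthogonal hUC μ (sensedChannels hUC σ π ω k)) ∂law U μ
        + ∫ ω, ind (¬ Regular hUC μ σ π M k (states hUC σ π ω k) (ω k).2) ∂law U μ) := by
  have h1 := integrable_slot hUC μ σ π k fun s x => ind (Regular hUC μ σ π M k s x.2 ∧
          ¬ Orthogonal hUC μ (channels hUC σ π k s x.2))
  have h2 := integrable_slot hUC μ σ π k fun s x => ind (¬ Regular hUC μ σ π M k s x.2)
  rw [← integral_add (by exact h1) h2, ← integral_const_mul]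
  refine integral_mono (integrable_slot hUC μ σ π k fun s x =>
    loss hUC μ (channels hUC σ π k s x.2)) ((h1.add h2).const_mul _) fun ω => ?_
  simp only [sensedChannels_eq]
  by_cases hO : Orthogonal hUC μ (channels hUC σ π k (states hUC σ π ω k) (ω k).2)
  · rw [loss_of_orthogonal hO]
    exact mul_nonneg (by positivity) (add_nonneg (ind_nonneg _) (ind_nonneg _))
  · refine (loss_le hUC μ _).trans ?_
    by_cases hR : Regular hUC μ σ π M k (states hUC σ π ω k) (ω k).2 <;> simp [ind, hR, hO]

/-- The regret of the random allocation policy grows at most logarithmically. -/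
theorem regret_le_log (hpos : ∀ i, 0 < (μ i : ℝ)) (hinj : Function.Injective μ)
    (hσ : ∀ j, IsRankingRule (σ j)) :
    ∃ c : ℝ, 0 < c ∧ ∃ n₀ : ℕ, ∀ n : ℕ, n₀ ≤ n → regret hUC μ σ π n ≤ c * Real.log n := by
  obtain ⟨ε, hε, hμ⟩ := exists_separated hinj
  obtain ⟨K, hK⟩ := exists_nat_ge (max (2 / ε ^ 2 : ℝ) ((max C 1 : ℕ) : ℝ))
  have hKC : max C 1 ≤ K := by exact_mod_cast (le_max_right _ _).trans hK
  have hC : C ≤ K := (le_max_left _ _).trans hKC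
  have hK1 : 1 ≤ K := (le_max_right _ _).trans hKC
  have hK2 : 2 ≤ ε ^ 2 * K := by
    have := (le_max_left _ _).trans hK
    rwa [div_le_iff₀ (by positivity), mul_comm] at this
  set p := (∏ i, (μ i : ℝ)) * ((U : ℝ)⁻¹) ^ U with hp
  have hp0 : 0 < p := by
    have hU : (0 : ℝ) < U := by exact_mod_cast Nat.pos_of_ne_zero (NeZero.ne U)
    have : 0 < ∏ i, (μ i : ℝ) := Finset.prod_pos fun i _ => hpos i
    positivity
  let L : ℝ := 8 / ε ^ 2
  have hL0 : 0 < L := by positivity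
  let Y : ℝ := 2 * U * C * 2 + U * (C * (L + 1))
  have hY : 0 ≤ Y := by positivity
  refine ⟨U * K + U * ((1 + Y) / p + Y) + 1, by positivity, max K 3, fun n hn => ?_⟩
  have hnK : K ≤ n := (le_max_left _ _).trans hn
  have hn3 : (3 : ℝ) ≤ n := by exact_mod_cast (le_max_right _ _).trans hn
  have hlog1 : 1 ≤ Real.log n := by
    rw [Real.le_log_iff_exp_le (by linarith)]
    linarith [Real.exp_one_lt_d9]
  -- The exploration threshold is tied to the horizon `n`, so that one `M` serves all slots up to
  -- `n`.
  let M : ℕ := ⌈L * Real.log n⌉₊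
  have hM : 8 * Real.log n ≤ ε ^ 2 * M := by
    have := mul_le_mul_of_nonneg_left (Nat.le_ceil (L * Real.log n)) (sq_nonneg ε)
    refine le_trans (le_of_eq ?_) this
    simp only [L]
    field_simp
  have hM1 : (M : ℝ) ≤ (L + 1) * Real.log n := by
    have := (Nat.ceil_lt_add_one (show 0 ≤ L * Real.log n by positivity)).le
    linarith
  set y := ∑ k ∈ Finset.Ico K n,
    ∫ ω, ind (¬ Regular hUC μ σ π M k (states hUC σ π ω k) (ω k).2) ∂law U μ with hy
  set x := ∑ k ∈ Finset.Ico K n,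
    ∫ ω, ind (Regular hUC μ σ π M k (states hUC σ π ω k) (ω k).2 ∧
          ¬ Orthogonal hUC μ (sensedChannels hUC σ π ω k)) ∂law U μ with hx
  have hyY : y ≤ Y * Real.log n := by
    refine (sum_integral_not_regular_le hC hK1).trans ?_
    calc (2 * U * C * (1 + Real.log n) + U * (C * M) : ℝ)
        ≤ 2 * U * C * (2 * Real.log n) + U * (C * ((L + 1) * Real.log n)) := by
          gcongr
          linarith
      _ = Y * Real.log n := by simp only [Y]; ring
  have hxp : x ≤ (1 + Y) / p * Real.log n := by
    have h1 : p * x ≤ 1 + y :=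
      sum_integral_not_orthogonal_le hσ hε hμ hC hK1 hK2 hM hnK
    rw [div_mul_eq_mul_div, le_div_iff₀ hp0]
    linarith
  rw [regret_eq, Finset.range_eq_Ico, ← Finset.sum_Ico_consecutive _ (Nat.zero_le K) hnK]
  have hfirst : ∑ k ∈ Finset.Ico 0 K, ∫ ω, loss hUC μ (sensedChannels hUC σ π ω k) ∂law U μ
      ≤ U * K := by
    calc _ ≤ ∑ k ∈ Finset.Ico 0 K, (U : ℝ) := by
          refine Finset.sum_le_sum fun k _ => ?_
          calc _ ≤ ∫ _ω : Outcome U C, (U : ℝ) ∂law U μ :=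
              integral_mono (integrable_slot hUC μ σ π k fun s x =>
                loss hUC μ (channels hUC σ π k s x.2)) (integrable_const _) fun ω => loss_le hUC μ _
            _ = U := by simp
      _ = U * K := by simp [mul_comm]
  have hrest : ∑ k ∈ Finset.Ico K n, ∫ ω, loss hUC μ (sensedChannels hUC σ π ω k) ∂law U μ
      ≤ U * (x + y) := by
    rw [hx, hy, ← Finset.sum_add_distrib, Finset.mul_sum]
    exact Finset.sum_le_sum fun k _ => integral_loss_le M k
  calc _ ≤ U * K + U * (x + y) := add_le_add hfirst hrest
    _ ≤ U * K * Real.log n + U * ((1 + Y) / p * Real.log n + Y * Real.log n) := by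
        refine add_le_add ?_ (by gcongr)
        exact le_mul_of_one_le_right (show (0 : ℝ) ≤ U * K by positivity) hlog1
    _ ≤ _ := by nlinarith

end UpperBound

/-! ### Change of the mean of one channel. -/

section ChangeOfMeasure

variable {U C : ℕ}

/-- Changing the mean of channel `i` does not affect averages that do not depend on it. -/
lemma sum_freeWeight_update (μ : Fin C → unitInterval) (i : Fin C) (v : unitInterval)
    {h : (Fin C → Bool) → ℝ} (hh : ∀ w b, h (Function.update w i b) = h w) :
    ∑ w, freeWeight (Function.update μ i v) w * h w = ∑ w, freeWeight μ w * h w := by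
  -- Pairing each vector with its flip at `i` makes the weights of coordinate `i` add up to `1`,
  -- whatever its mean.
  let flip : (Fin C → Bool) → Fin C → Bool := fun w => Function.update w i (!w i)
  have hflip : Function.Involutive flip := fun w => by simp [flip]
  have hsum (ν : Fin C → unitInterval) : 2 * ∑ w, freeWeight ν w * h w
      = ∑ w, (∏ l ∈ Finset.univ.erase i, bernWeight (ν l) (w l)) * h w := by
    have e : ∑ w, freeWeight ν w * h w = ∑ w, freeWeight ν (flip w) * h (flip w) :=
      (Equiv.sum_comp hflip.toPerm fun w => freeWeight ν w * h w).symm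
    rw [two_mul]
    nth_rewrite 2 [e]
    rw [← Finset.sum_add_distrib]
    refine Finset.sum_congr rfl fun w _ => ?_
    have hrest : ∏ l ∈ Finset.univ.erase i, bernWeight (ν l) (flip w l)
        = ∏ l ∈ Finset.univ.erase i, bernWeight (ν l) (w l) :=
      Finset.prod_congr rfl fun l hl => by
        simp only [flip, Function.update_of_ne (Finset.ne_of_mem_erase hl)]
    have hi : bernWeight (ν i) (w i) + bernWeight (ν i) (flip w i) = 1 := by
      cases hw : w i <;> simp [flip, bernWeight, hw]
    rw [freeWeight, freeWeight, ← Finset.mul_prod_erase _ _ (Finset.mem_univ i),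
      ← Finset.mul_prod_erase _ (fun l => bernWeight (ν l) (flip w l)) (Finset.mem_univ i), hrest,
      show h (flip w) = h w from hh _ _, ← add_mul, ← add_mul, hi, one_mul]
  have : ∑ w, (∏ l ∈ Finset.univ.erase i, bernWeight (Function.update μ i v l) (w l)) * h w
      = ∑ w, (∏ l ∈ Finset.univ.erase i, bernWeight (μ l) (w l)) * h w := by
    refine Finset.sum_congr rfl fun w _ => ?_
    congr 1
    exact Finset.prod_congr rfl fun l hl => by
      rw [Function.update_of_ne (Finset.ne_of_mem_erase hl)]
  have h1 := hsum μ
  have h2 := hsum (Function.update μ i v)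
  linarith

lemma freeWeight_le_mul_update (μ : Fin C → unitInterval) (i : Fin C) (v : unitInterval) {r : ℝ}
    (hr : ∀ b, bernWeight (μ i) b ≤ r * bernWeight v b) (w : Fin C → Bool) :
    freeWeight μ w ≤ r * freeWeight (Function.update μ i v) w := by
  rw [freeWeight, freeWeight, ← Finset.mul_prod_erase _ _ (Finset.mem_univ i),
    ← Finset.mul_prod_erase _ (fun l => bernWeight (Function.update μ i v l) (w l))
      (Finset.mem_univ i), Function.update_self, ← mul_assoc]
  have : ∏ l ∈ Finset.univ.erase i, bernWeight (Function.update μ i v l) (w l)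
      = ∏ l ∈ Finset.univ.erase i, bernWeight (μ l) (w l) :=
    Finset.prod_congr rfl fun l hl => by
      rw [Function.update_of_ne (Finset.ne_of_mem_erase hl)]
  rw [this]
  exact mul_le_mul_of_nonneg_right (hr _) (Finset.prod_nonneg fun l _ => bernWeight_nonneg _ _)

/-- A channel that nobody senses reveals nothing; hence only visited slots cost a likelihood factor.
-/
lemma nextStates_update (hUC : U ≤ C) (σ : Fin U → (Fin C → ℝ) → Equiv.Perm (Fin C))
    (π : Fin U → Equiv.Perm (Fin C)) {i : Fin C} {k : ℕ} {s : Fin U → UserState U C} {d : Fin U → Fin U}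
    (hi : ∀ j, channels hUC σ π k s d j ≠ i) (w : Fin C → Bool) (b : Bool) :
    nextStates hUC σ π k s (Function.update w i b, d) = nextStates hUC σ π k s (w, d) := by
  funext j
  simp only [nextStates, nextState, Function.update_of_ne (hi j), UserState.mk.injEq, true_and]
  refine ⟨funext fun l => ?_, by simp [Function.update_of_ne (hi j)]⟩
  by_cases hl : l = i
  · simp [hl, hi j]
  · simp [Function.update_of_ne hl]

variable [NeZero U] (hUC : U ≤ C) (σ : Fin U → (Fin C → ℝ) → Equiv.Perm (Fin C))
  (π : Fin U → Equiv.Perm (Fin C))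

open Classical in
/-- The number of slots among the first `n` in which some user senses channel `i`. -/
noncomputable def visits (i : Fin C) (ω : Outcome U C) (n : ℕ) : ℕ :=
  ∑ k ∈ Finset.range n, if ∃ j, sensedChannels hUC σ π ω k j = i then 1 else 0

lemma visits_le (i : Fin C) (ω : Outcome U C) (n : ℕ) : visits hUC σ π i ω n ≤ n := by
  calc visits hUC σ π i ω n ≤ ∑ _k ∈ Finset.range n, 1 :=
        Finset.sum_le_sum fun k _ => by split_ifs <;> simp
    _ = n := by simp

lemma visits_eq_sum_ind (i : Fin C) (ω : Outcome U C) (n : ℕ) :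
    (visits hUC σ π i ω n : ℝ)
      = ∑ k ∈ Finset.range n, ind (∃ j, sensedChannels hUC σ π ω k j = i) := by
  rw [visits, Nat.cast_sum]
  exact Finset.sum_congr rfl fun k _ => by
    by_cases h : ∃ j, sensedChannels hUC σ π ω k j = i <;> simp [ind, h]

lemma dependsOn_visits (i : Fin C) (n : ℕ) :
    DependsOn (fun ω => visits hUC σ π i ω n) (Set.Iio n) := by
  intro ω ω' h
  refine Finset.sum_congr rfl fun k hk => ?_
  have hk' : k < n := Finset.mem_range.1 hk
  have h1 : states hUC σ π ω k = states hUC σ π ω' k :=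
    dependsOn_states hUC σ π k fun l hl => h l (Set.mem_Iio.2 (lt_trans hl hk'))
  have h2 : sensedChannels hUC σ π ω k = sensedChannels hUC σ π ω' k := by
    rw [sensedChannels_eq, sensedChannels_eq, h1, h k hk']
  rw [h2]

lemma dependsOn_comp_states_visits {α : Type*} (i : Fin C) (n : ℕ)
    (f : (Fin U → UserState U C) → ℕ → α) :
    DependsOn (fun ω => f (states hUC σ π ω n) (visits hUC σ π i ω n)) (Set.Iio n) := by
  intro ω ω' h
  have h1 := dependsOn_states hUC σ π n h
  have h2 := dependsOn_visits hUC σ π i n h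
  simp only at h1 h2
  simp only [h1, h2]

/-- If `r` bounds the likelihood ratio of one observation of channel `i`, then `r ^ N` bounds the
likelihood ratio of the states after `N` visits of channel `i`. -/
lemma integral_visits_le (μ : Fin C → unitInterval) (i : Fin C) (v : unitInterval) {r : ℝ}
    (hr0 : 0 < r) (hr : ∀ b, bernWeight (μ i) b ≤ r * bernWeight v b) (n : ℕ)
    (f : (Fin U → UserState U C) → ℕ → ℝ) (hf : ∀ s N, 0 ≤ f s N) :
    ∫ ω, (r⁻¹) ^ visits hUC σ π i ω n * f (states hUC σ π ω n) (visits hUC σ π i ω n) ∂law U μ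
      ≤ ∫ ω, f (states hUC σ π ω n) (visits hUC σ π i ω n)
          ∂law U (Function.update μ i v) := by
  classical
  induction n generalizing f with
  | zero => simp [visits, states]
  | succ n ih =>
    set μ' := Function.update μ i v with hμ'
    let c : (Fin U → UserState U C) → (Fin U → Fin U) → ℕ := fun s d =>
      if ∃ j, channels hUC σ π n s d j = i then 1 else 0
    let g : (Fin U → UserState U C) → ℕ → SlotInput U C → ℝ := fun s N x =>
      f (nextStates hUC σ π n s x) (N + c s x.2)
    -- One step of conditional expectation of `f` under the changed law; the induction hypothesis is
    -- applied to it.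
    let f' : (Fin U → UserState U C) → ℕ → ℝ := fun s N =>
      ∑ x, (slotLaw U μ').real {x} * g s N x
    have hv (ω : Outcome U C) : visits hUC σ π i ω (n + 1)
        = visits hUC σ π i ω n + c (states hUC σ π ω n) (ω n).2 := by
      simp only [visits, Finset.sum_range_succ, c, ← sensedChannels_eq]
      congr
    have hg0 : ∀ s N x, 0 ≤ g s N x := fun s N x => hf _ _
    have hf' : ∀ s N, 0 ≤ f' s N := fun s N =>
      Finset.sum_nonneg fun x _ => mul_nonneg measureReal_nonneg (hg0 s N x)
    have hle (s : Fin U → UserState U C) (N : ℕ) :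
        ∑ x, (slotLaw U μ).real {x} * ((r⁻¹) ^ c s x.2 * g s N x) ≤ f' s N := by
      simp only [f', sum_slotLaw]
      refine Finset.sum_le_sum fun d _ => mul_le_mul_of_nonneg_left ?_ (by positivity)
      by_cases ht : ∃ j, channels hUC σ π n s d j = i
      · have hc : c s d = 1 := if_pos ht
        refine Finset.sum_le_sum fun w _ => ?_
        rw [hc, pow_one, ← mul_assoc]
        refine mul_le_mul_of_nonneg_right ?_ (hg0 _ _ _)
        rw [mul_inv_le_iff₀ hr0, mul_comm]
        exact freeWeight_le_mul_update μ i v hr w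
      · have hc : c s d = 0 := if_neg ht
        simp only [hc, pow_zero, one_mul]
        refine (sum_freeWeight_update μ i v fun w b => ?_).ge
        simp only [g]
        rw [nextStates_update hUC σ π fun j hj => ht ⟨j, hj⟩]
    calc ∫ ω, (r⁻¹) ^ visits hUC σ π i ω (n + 1)
          * f (states hUC σ π ω (n + 1)) (visits hUC σ π i ω (n + 1)) ∂law U μ
        = ∫ ω, (r⁻¹) ^ (visits hUC σ π i ω n + c (states hUC σ π ω n) (ω n).2)
            * g (states hUC σ π ω n) (visits hUC σ π i ω n) (ω n) ∂law U μ := by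
          simp only [hv, states_succ, g]
      _ = ∫ ω, ∑ x, (slotLaw U μ).real {x} *
            ((r⁻¹) ^ (visits hUC σ π i ω n + c (states hUC σ π ω n) x.2)
            * g (states hUC σ π ω n) (visits hUC σ π i ω n) x) ∂law U μ :=
          integral_step μ (F := fun ω x =>
            (r⁻¹) ^ (visits hUC σ π i ω n + c (states hUC σ π ω n) x.2)
            * g (states hUC σ π ω n) (visits hUC σ π i ω n) x) fun x =>
            dependsOn_comp_states_visits hUC σ π i n fun s N => (r⁻¹) ^ (N + c s x.2) * g s N x
      _ ≤ ∫ ω, (r⁻¹) ^ visits hUC σ π i ω n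
            * f' (states hUC σ π ω n) (visits hUC σ π i ω n) ∂law U μ := by
          refine integral_mono
            (integrable_of_dependsOn μ (dependsOn_comp_states_visits hUC σ π i n fun s N =>
              ∑ x, (slotLaw U μ).real {x} * ((r⁻¹) ^ (N + c s x.2) * g s N x)))
            (integrable_of_dependsOn μ (dependsOn_comp_states_visits hUC σ π i n fun s N =>
              (r⁻¹) ^ N * f' s N)) fun ω => ?_
          refine le_trans (le_of_eq ?_) (mul_le_mul_of_nonneg_left
            (hle (states hUC σ π ω n) (visits hUC σ π i ω n)) (by positivity))
          rw [Finset.mul_sum]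
          refine Finset.sum_congr rfl fun x _ => ?_
          rw [pow_add]
          ring
      _ ≤ ∫ ω, f' (states hUC σ π ω n) (visits hUC σ π i ω n) ∂law U μ' := ih f' hf'
      _ = ∫ ω, g (states hUC σ π ω n) (visits hUC σ π i ω n) (ω n) ∂law U μ' :=
          (integral_step μ' (F := fun ω x =>
            g (states hUC σ π ω n) (visits hUC σ π i ω n) x) fun x =>
            dependsOn_comp_states_visits hUC σ π i n fun s N => g s N x).symm
      _ = _ := by simp only [hv, states_succ, g]

end ChangeOfMeasure

/-! ### Logarithmic lower bound. -/

section LowerBound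

variable {U C : ℕ} [NeZero U] {hUC : U ≤ C} {μ : Fin C → unitInterval}
  {σ : Fin U → (Fin C → ℝ) → Equiv.Perm (Fin C)} {π : Fin U → Equiv.Perm (Fin C)}

lemma integrable_visits (i : Fin C) (n : ℕ) (f : ℕ → ℝ) :
    Integrable (fun ω => f (visits hUC σ π i ω n)) (law U μ) :=
  integrable_of_dependsOn μ (dependsOn_comp_states_visits hUC σ π i n fun _ N => f N)

lemma integrable_loss (k : ℕ) :
    Integrable (fun ω => loss hUC μ (sensedChannels hUC σ π ω k)) (law U μ) :=
  integrable_slot hUC μ σ π k fun s x => loss hUC μ (channels hUC σ π k s x.2)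

/-- Visits of a channel that is not among the `U` best cause regret. -/
lemma mul_integral_visits_le_regret {δ : ℝ} (hδ : 0 < δ)
    (h : ∀ a : Fin U → Fin C, ¬ Orthogonal hUC μ a → δ ≤ loss hUC μ a) {i : Fin C}
    (hi : i ∉ topChannels hUC μ) (n : ℕ) :
    δ * ∫ ω, (visits hUC σ π i ω n : ℝ) ∂law U μ ≤ regret hUC μ σ π n := by
  rw [regret_eq, ← integral_finsetSum _ fun k _ => integrable_loss k, ← integral_const_mul]
  refine integral_mono ((integrable_visits i n fun N => (N : ℝ)).const_mul _)
    (integrable_finsetSum _ fun k _ => integrable_loss k) fun ω => ?_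
  simp only [visits_eq_sum_ind, Finset.mul_sum]
  refine Finset.sum_le_sum fun k _ => ?_
  by_cases hv : ∃ j, sensedChannels hUC σ π ω k j = i
  · rw [ind_of_true hv, mul_one]
    obtain ⟨j, hj⟩ := hv
    exact h _ fun ho => hi (hj ▸ ho.1 j)
  · rw [ind_of_false hv, mul_zero]
    exact loss_nonneg hδ h _

/-- Slots without a visit of one of the `U` best channels cause regret. -/
lemma mul_integral_sub_visits_le_regret {δ : ℝ} (hδ : 0 < δ)
    (h : ∀ a : Fin U → Fin C, ¬ Orthogonal hUC μ a → δ ≤ loss hUC μ a) {i : Fin C}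
    (hi : i ∈ topChannels hUC μ) (n : ℕ) :
    δ * ∫ ω, ((n : ℝ) - visits hUC σ π i ω n) ∂law U μ ≤ regret hUC μ σ π n := by
  classical
  rw [regret_eq, ← integral_finsetSum _ fun k _ => integrable_loss k, ← integral_const_mul]
  refine integral_mono ((integrable_visits i n fun N => (n : ℝ) - N).const_mul _)
    (integrable_finsetSum _ fun k _ => integrable_loss k) fun ω => ?_
  have : (n : ℝ) - visits hUC σ π i ω n
      = ∑ k ∈ Finset.range n, (1 - ind (∃ j, sensedChannels hUC σ π ω k j = i)) := by
    rw [visits_eq_sum_ind, Finset.sum_sub_distrib]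
    simp
  beta_reduce
  rw [this, Finset.mul_sum]
  refine Finset.sum_le_sum fun k _ => ?_
  by_cases hv : ∃ j, sensedChannels hUC σ π ω k j = i
  · rw [ind_of_true hv, sub_self, mul_zero]
    exact loss_nonneg hδ h _
  · rw [ind_of_false hv, sub_zero, mul_one]
    refine h _ fun ho => hv ?_
    rw [← (aloneChannels_eq_iff _).2 ho] at hi
    obtain ⟨j, -, hj⟩ := Finset.mem_image.1 hi
    exact ⟨j, hj⟩

/-- If the regret is at most logarithmic after channel `i` is made one of the `U` best, then
channel `i` is visited logarithmically often. -/
lemma exists_log_le_integral_visits {i : Fin C} {v : unitInterval} (hv0 : 0 < (v : ℝ))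
    (hv1 : (v : ℝ) < 1) {δ c : ℝ} (hδ : 0 < δ)
    (h : ∀ a : Fin U → Fin C, ¬ Orthogonal hUC (Function.update μ i v) a →
      δ ≤ loss hUC (Function.update μ i v) a)
    (hi : i ∈ topChannels hUC (Function.update μ i v)) {n₀ : ℕ} (hc : 0 < c)
    (hreg : ∀ n : ℕ, n₀ ≤ n → regret hUC (Function.update μ i v) σ π n ≤ c * Real.log n) :
    ∃ a : ℝ, 0 < a ∧ ∃ n₁ : ℕ, ∀ n : ℕ, n₁ ≤ n →
      a * Real.log n ≤ ∫ ω, (visits hUC σ π i ω n : ℝ) ∂law U μ := by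
  let r : ℝ := max (Real.exp 1) (max (1 / v) (1 / (1 - v)))
  have hre : Real.exp 1 ≤ r := le_max_left _ _
  have hr0 : 0 < r := (Real.exp_pos 1).trans_le hre
  have hr : ∀ b, bernWeight (μ i) b ≤ r * bernWeight v b := by
    have hb : ∀ b, bernWeight (μ i) b ≤ 1 := by
      intro b
      unfold bernWeight
      split_ifs
      · exact (μ i).2.2
      · linarith [(μ i).2.1]
    refine fun b => (hb b).trans ?_
    have hv1' : 0 < 1 - (v : ℝ) := by linarith
    cases b
    · have : 1 / (1 - (v : ℝ)) ≤ r := (le_max_right _ _).trans (le_max_right _ _)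
      simpa [bernWeight] using (div_le_iff₀ hv1').1 this
    · have : 1 / (v : ℝ) ≤ r := (le_max_left _ _).trans (le_max_right _ _)
      simpa [bernWeight] using (div_le_iff₀ hv0).1 this
  have hlr : 1 ≤ Real.log r := (Real.le_log_iff_exp_le hr0).2 hre
  -- With at most `b * log n` visits the likelihood ratio is at most `√n`, while the probability of
  -- so few visits under the changed law is `O(log n / n)`. Having `r ≥ exp 1` ensures `b ≤ 1 / 2`.
  let b : ℝ := 1 / (2 * Real.log r)
  have hb0 : 0 < b := by positivity
  have hb1 : b ≤ 1 / 2 := by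
    simp only [b]
    gcongr
    linarith
  have hlim : ∀ᶠ n : ℕ in Filter.atTop,
      Real.log n ≤ δ / (4 * c) * (n : ℝ) ^ (1 / 2 : ℝ) := by
    have h1 := (isLittleO_log_rpow_atTop (r := 1 / 2) (by norm_num)).bound
      (show 0 < δ / (4 * c) by positivity)
    filter_upwards [tendsto_natCast_atTop_atTop.eventually h1] with n hn
    refine (Real.le_norm_self _).trans (hn.trans (le_of_eq ?_))
    rw [Real.norm_of_nonneg (by positivity)]
  obtain ⟨n₂, hn₂⟩ := Filter.eventually_atTop.1 hlim
  refine ⟨b / 2, by positivity, max n₂ (max n₀ 1), fun n hn => ?_⟩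
  have hl := hn₂ n ((le_max_left _ _).trans hn)
  have hR := hreg n ((le_max_left _ _).trans ((le_max_right _ _).trans hn))
  have hn1 : 1 ≤ n := (le_max_right _ _).trans ((le_max_right _ _).trans hn)
  have hn0 : (0 : ℝ) < n := by exact_mod_cast hn1
  have hlog0 : 0 ≤ Real.log n := Real.log_nonneg (by exact_mod_cast hn1)
  set q : ℝ := (n : ℝ) ^ (1 / 2 : ℝ) with hq
  have hq0 : 0 < q := by positivity
  have hqq : q * q = n := by
    rw [hq, ← Real.rpow_add hn0]
    norm_num
  let m : ℕ := ⌊b * Real.log n⌋₊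
  have hm : (m : ℝ) ≤ b * Real.log n := Nat.floor_le (by positivity)
  have hm' : b * Real.log n < m + 1 := Nat.lt_floor_add_one _
  have hmn : (m : ℝ) ≤ n / 2 := by
    have h1 : b * Real.log n ≤ 1 / 2 * n := by
      have := Real.log_le_self hn0.le
      gcongr
    linarith
  have hrm : r ^ m ≤ q := by
    rw [hq, Real.rpow_def_of_pos hn0, ← Real.exp_log (pow_pos hr0 m), Real.log_pow]
    refine Real.exp_le_exp.2 ?_
    calc (m : ℝ) * Real.log r ≤ b * Real.log n * Real.log r := by gcongr
      _ = Real.log n * (1 / 2) := by simp only [b]; field_simp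
  set μ' := Function.update μ i v with hμ'
  set P := ∫ ω, ind (visits hUC σ π i ω n ≤ m) ∂law U μ with hP
  set P' := ∫ ω, ind (visits hUC σ π i ω n ≤ m) ∂law U μ' with hP'
  have hPP' : P ≤ r ^ m * P' := by
    have h1 := integral_visits_le hUC σ π μ i v hr0 hr n (fun _ N => ind (N ≤ m))
      fun _ _ => ind_nonneg _
    rw [← inv_mul_le_iff₀ (pow_pos hr0 m), ← inv_pow]
    refine le_trans ?_ h1
    rw [hP, ← integral_const_mul]
    refine integral_mono ((integrable_visits i n fun N => ind (N ≤ m)).const_mul _)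
      (integrable_visits i n fun N => (r⁻¹) ^ N * ind (N ≤ m)) fun ω => ?_
    by_cases hN : visits hUC σ π i ω n ≤ m
    · simp only [ind_of_true hN, mul_one]
      refine pow_le_pow_of_le_one (by positivity) (inv_le_one_of_one_le₀ ?_) hN
      exact (Real.one_le_exp zero_le_one).trans hre
    · simp [ind_of_false hN]
  -- With at most `m ≤ n / 2` visits, at least `n / 2` slots miss a best channel of the changed
  -- model, each at a cost of at least `δ`.
  have hP'le : δ * (n / 2) * P' ≤ c * Real.log n := by
    refine le_trans ?_ hR
    refine le_trans ?_ (mul_integral_sub_visits_le_regret hδ h hi n)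
    rw [mul_assoc]
    refine mul_le_mul_of_nonneg_left ?_ hδ.le
    rw [hP', ← integral_const_mul]
    refine integral_mono ((integrable_visits i n fun N => ind (N ≤ m)).const_mul _)
      (integrable_visits i n fun N => (n : ℝ) - N) fun ω => ?_
    by_cases hN : visits hUC σ π i ω n ≤ m
    · have : (visits hUC σ π i ω n : ℝ) ≤ m := by exact_mod_cast hN
      simp only [ind_of_true hN, mul_one]
      linarith
    · have : (visits hUC σ π i ω n : ℝ) ≤ n := by exact_mod_cast visits_le hUC σ π i ω n
      simp only [ind_of_false hN, mul_zero]
      linarith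
  have hP'0 : 0 ≤ P' := integral_nonneg fun ω => ind_nonneg _
  have hPhalf : P ≤ 1 / 2 := by
    have h1 : P ≤ q * P' := hPP'.trans (mul_le_mul_of_nonneg_right hrm hP'0)
    have h2 : c * Real.log n ≤ δ / 4 * q := by
      calc c * Real.log n ≤ c * (δ / (4 * c) * q) := by gcongr
        _ = δ / 4 * q := by field_simp
    have h3 : δ / 2 * q * (q * P') ≤ δ / 2 * q * (1 / 2) := by
      calc δ / 2 * q * (q * P') = δ * (n / 2) * P' := by rw [← hqq]; ring
        _ ≤ δ / 4 * q := hP'le.trans h2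
        _ = _ := by ring
    exact h1.trans (le_of_mul_le_mul_left h3 (by positivity))
  -- Markov's inequality for the integer-valued number of visits, where more than `m` means at least
  -- `m + 1`.
  have hfin : ((m : ℝ) + 1) * (1 - P) ≤ ∫ ω, (visits hUC σ π i ω n : ℝ) ∂law U μ := by
    have e : 1 - P = ∫ ω, (1 - ind (visits hUC σ π i ω n ≤ m)) ∂law U μ := by
      rw [integral_sub (integrable_const _) (integrable_visits i n fun N => ind (N ≤ m))]
      simp [hP]
    rw [e, ← integral_const_mul]
    refine integral_mono ((integrable_visits i n fun N => 1 - ind (N ≤ m)).const_mul _)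
      (integrable_visits i n fun N => (N : ℝ)) fun ω => ?_
    by_cases hN : visits hUC σ π i ω n ≤ m
    · simp [ind_of_true hN]
    · simp only [ind_of_false hN, sub_zero, mul_one]
      exact_mod_cast not_le.1 hN
  calc b / 2 * Real.log n ≤ ((m : ℝ) + 1) * (1 / 2) := by linarith
    _ ≤ ((m : ℝ) + 1) * (1 - P) := by gcongr; linarith
    _ ≤ _ := hfin

/-- With more channels than users, the regret grows at least logarithmically. -/
theorem log_le_regret (hlt : U < C) (hμ : ∀ i, 0 < (μ i : ℝ) ∧ (μ i : ℝ) < 1)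
    (hinj : Function.Injective μ) (hσ : ∀ j, IsRankingRule (σ j)) :
    ∃ c : ℝ, 0 < c ∧ ∃ n₀ : ℕ, ∀ n : ℕ, n₀ ≤ n → c * Real.log n ≤ regret hUC μ σ π n := by
  obtain ⟨i, -, hi⟩ : ∃ i ∈ Finset.univ, i ∉ topChannels hUC μ := by
    apply Finset.exists_mem_notMem_of_card_lt_card
    simpa [card_topChannels] using hlt
  -- A mean above all others makes `i` the best channel and keeps the means distinct; staying below
  -- `1` keeps the likelihood ratios finite.
  obtain ⟨v, hv, hv1⟩ : ∃ v : ℝ, (∀ l, (μ l : ℝ) < v) ∧ v < 1 := by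
    have h1 : ∀ᶠ v in nhdsWithin (1 : ℝ) (Set.Iio 1), ∀ l, (μ l : ℝ) < v :=
      Filter.eventually_all.2 fun l =>
        (eventually_gt_nhds (hμ l).2).filter_mono nhdsWithin_le_nhds
    exact (h1.and self_mem_nhdsWithin).exists
  have hv0 : 0 < v := (hμ i).1.trans (hv i)
  let v' : unitInterval := ⟨v, hv0.le, hv1.le⟩
  have hne : ∀ l, μ l ≠ v' := fun l e => (hv l).ne (congrArg Subtype.val e)
  have hinj' : Function.Injective (Function.update μ i v') := by
    intro l l' e
    by_cases hl : l = i <;> by_cases hl' : l' = i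
    · rw [hl, hl']
    · rw [hl, Function.update_self, Function.update_of_ne hl'] at e
      exact absurd e.symm (hne l')
    · rw [hl', Function.update_self, Function.update_of_ne hl] at e
      exact absurd e (hne l)
    · rw [Function.update_of_ne hl, Function.update_of_ne hl'] at e
      exact hinj e
  have hpos' : ∀ l, 0 < (Function.update μ i v' l : ℝ) := by
    intro l
    by_cases hl : l = i
    · rw [hl, Function.update_self]
      exact hv0
    · rw [Function.update_of_ne hl]
      exact (hμ l).1
  have htop : i ∈ topChannels hUC (Function.update μ i v') := by
    refine Finset.mem_image.2 ⟨0, Finset.mem_univ _, ?_⟩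
    set l := bestChannel (Function.update μ i v') (Fin.castLE hUC 0) with hl
    by_contra hne'
    have h1 := antitone_bestChannel (Function.update μ i v')
      (show Fin.castLE hUC 0 ≤ (bestChannel (Function.update μ i v')).symm i by
        rw [Fin.le_def]; simp)
    simp only [Function.comp_apply, Equiv.apply_symm_apply, ← hl] at h1
    rw [Function.update_self, Function.update_of_ne hne'] at h1
    exact absurd h1 (not_le.2 (hv l))
  obtain ⟨δ, hδ, hloss⟩ := exists_le_loss (hUC := hUC) (fun l => (hμ l).1) hinj
  obtain ⟨δ', hδ', hloss'⟩ := exists_le_loss (hUC := hUC) hpos' hinj'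
  obtain ⟨c, hc, n₀, hreg⟩ := regret_le_log (hUC := hUC) (π := π) hpos' hinj' hσ
  obtain ⟨a, ha, n₁, hvis⟩ :=
    exists_log_le_integral_visits (μ := μ) hv0 hv1 hδ' hloss' htop hc hreg
  refine ⟨δ * a, by positivity, n₁, fun n hn => ?_⟩
  rw [mul_assoc]
  exact (mul_le_mul_of_nonneg_left (hvis n hn) hδ.le).trans
    (mul_integral_visits_le_regret hδ hloss hi n)

end LowerBound

end RandAlloc

theorem mainTheorem1 (U C : ℕ) [NeZero U] (hUC : U ≤ C)
    (μ : Fin C → unitInterval) (hμ : ∀ i, 0 < (μ i : ℝ) ∧ (μ i : ℝ) < 1)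
    (hdistinct : Function.Injective μ)
    (σ : Fin U → (Fin C → ℝ) → Equiv.Perm (Fin C)) (hσ : ∀ j, RandAlloc.IsRankingRule (σ j))
    (π : Fin U → Equiv.Perm (Fin C)) :
    (∃ c : ℝ, 0 < c ∧ ∃ n₀ : ℕ, ∀ n : ℕ, n₀ ≤ n →
      RandAlloc.regret hUC μ σ π n ≤ c * Real.log n) ∧
    (U < C → ∃ c' : ℝ, 0 < c' ∧ ∃ n₀ : ℕ, ∀ n : ℕ, n₀ ≤ n →
      c' * Real.log n ≤ RandAlloc.regret hUC μ σ π n) :=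
  ⟨RandAlloc.regret_le_log (fun i => (hμ i).1) hdistinct hσ,
    fun hlt => RandAlloc.log_le_regret hlt hμ hdistinct hσ⟩
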